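/- Logarithms are to base 2. Let $\mathcal X$ be a finite set, $\mathcal Y$ a measurable space, and $W=(W_x)_{x\in\mathcal X}$ a channel, i.e. a family of probability measures on $\mathcal Y$. Assume that $W$ is not noiseless: it is not the case that $|\mathcal X|\ge 2$ and the measures $W_x$ are pairwise mutually singular. For $x^n\in\mathcal X^n$ let $W^n_{x^n}=W_{x_1}\times\dots\times W_{x_n}$. **Codes.** A code for $n$ uses of $W$ consists of integers $1\le \mathsf L<\mathsf M$ (also written $|(\phi,D)|_2$ and $|(\phi,D)|_1$), a stochastic encoder $\phi$ assigning to each message $m\in\mathcal M=\{1,\dots,\mathsf M\}$ a probability distribution $\phi(m)$ on $\mathcal X^n$, and a measurable list decoder $D$ assigning to each $y\in\mathcal Y^n$ a set $\Psi(y)\subset\mathcal M$ with $|\Psi(y)|\le\mathsf L$. It is deterministic if each $\phi(m)$ is a point mass. Put $W^n_{\phi(m)}=\sum_{x^n}\phi(m)(x^n)W^n_{x^n}$ and $$\epsilon_A(\phi,D)=\max_m \bigl(1-W^n_{\phi(m)}(m\in\Psi)\bigr),\qquad \delta_C(\phi,D)=\max_{m}\max_{m'\ne m}W^n_{\phi(m)}(m'\in\Psi),$$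 $$\delta_D(D)=\max_{x^n\in\mathcal X^n}\ \bigl(\text{second largest value, with multiplicity, of } \{W^n_{x^n}(m\in\Psi)\}_{m\in\mathcal M}\bigr),$$ $$E(\phi)=\log\mathsf M-\min_Q\frac1{\mathsf M}\sum_{m}D\bigl(W^n_{\phi(m)}\,\|\,Q\bigr),$$ the minimum being over probability measures $Q$ on $\mathcal Y^n$. **Achievable triples.** A sequence of codes $(\phi_n,D_n)$, $(\phi_n,D_n)$ being for $n$ uses, is weakly secure if $\epsilon_A(\phi_n,D_n)\to0$ and $\delta_C(\phi_n,D_n)\to0$, and strongly secure if $\epsilon_A(\phi_n,D_n)\to0$ and $\delta_D(D_n)\to0$. A triple $(R_1,R_2,R_3)$ of nonnegative reals is achieved by the sequence if $\frac1n\log|(\phi_n,D_n)|_1\to R_1$, $\frac1n\log|(\phi_n,D_n)|_2\to R_2$ and $\liminf_n\frac1nE(\phi_n)\ge R_3$. Let $\mathcal R^L_{(w,d)}$, $\mathcal R^L_{(s,d)}$, $\mathcal R^L_{(s,s)}$ be the sets of triples achieved, respectively, by weakly secure sequences of deterministic codes, by strongly secure sequences of deterministic codes, and by strongly secure sequences of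 (stochastic) codes. **Regions.** For a distribution $P$ on $\mathcal U\times\mathcal X$ with $\mathcal U$ finite, let $U-X-Y$ be the Markov chain with $(U,X)\sim P$ and $Y\sim W_x$ given $X=x$. Let $\mathcal C$ be the set of $(R_1,R_2,R_3)\in(0,\infty)^3$ such that for some finite $\mathcal U$ and some $P$ $$0<R_1-R_2<I(X;Y|U)_P,\qquad R_3\le R_1-I(X;Y|U)_P,\qquad R_1<H(X|U)_P,$$ and let $\mathcal C^s$ be defined in the same way with $R_3\le R_1-I(X;Y|U)_P$ replaced by $R_3\le H(X|YU)_P$. **Theorem.** With closures taken in $\mathbb R^3$, $$\mathcal R^L_{(w,d)}\subset\overline{\mathcal C},\qquad \mathcal R^L_{(s,s)}\subset\overline{\mathcal C^s},\qquad \mathcal R^L_{(s,d)}\subset\overline{\mathcal C}.$$ -/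

import Mathlib

open MeasureTheory InformationTheory Filter Topology
open scoped ENNReal

noncomputable section

namespace SecureListDecoding

/-! ### Information quantities (all logarithms are to the base 2) -/

/-- Kullback-Leibler divergence of two probability measures, in bits. -/
def divergence {Y : Type*} [MeasurableSpace Y] (P Q : Measure Y) : ℝ≥0∞ :=
  klDiv P Q / ENNReal.ofReal (Real.log 2)

/-- The output distribution `W_p = ∑ x, p(x) W_x` of the channel `W` for the input distribution
`p`. -/
def outputMeasure {X Y : Type*} [Fintype X] [MeasurableSpace Y] (W : X → Measure Y)
    (p : X → ℝ) : Measure Y :=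
  ∑ x, ENNReal.ofReal (p x) • W x

/-- `I(X;Y)_p = ∑ x, p(x) D(W_x ‖ W_p)`. (A term with `p(x) > 0` has finite divergence.) -/
def mutualInfo {X Y : Type*} [Fintype X] [MeasurableSpace Y] (W : X → Measure Y)
    (p : X → ℝ) : ℝ :=
  ∑ x, p x * (divergence (W x) (outputMeasure W p)).toReal

/-- The posterior probability `P_{X|Y=y}(x)`, that is, `p(x)` times the density at `y` of `W_x`
with respect to `W_p`. -/
def posterior {X Y : Type*} [Fintype X] [MeasurableSpace Y] (W : X → Measure Y)
    (p : X → ℝ) (y : Y) (x : X) : ℝ :=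
  p x * ((W x).rnDeriv (outputMeasure W p) y).toReal

/-- The Shannon entropy `-∑ x, q(x) log q(x)`, in bits. -/
def entropy {X : Type*} [Fintype X] (q : X → ℝ) : ℝ :=
  -∑ x, q x * Real.logb 2 (q x)

/-- The equivocation `H(X|Y)_p = ∫ H(P_{X|Y=y}) W_p(dy)`. -/
def equivocation {X Y : Type*} [Fintype X] [MeasurableSpace Y] (W : X → Measure Y)
    (p : X → ℝ) : ℝ :=
  ∫ y, entropy (posterior W p y) ∂(outputMeasure W p)

/-- The marginal `P_U` of a joint distribution of `(U, X)`. -/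
def marginalU {U X : Type*} [Fintype X] (P : U × X → ℝ) (u : U) : ℝ :=
  ∑ x, P (u, x)

/-- The conditional distribution `P_{X|U=u}`; when `P_U(u) = 0` its value is irrelevant, because
it only occurs with the weight `P_U(u)`. -/
def condX {U X : Type*} [Fintype X] (P : U × X → ℝ) (u : U) (x : X) : ℝ :=
  P (u, x) / marginalU P u

/-- `H(X|U)_P = -∑ u, ∑ x, P(u,x) log (P(u,x) / P_U(u))`. -/
def condEntropy {U X : Type*} [Fintype U] [Fintype X] (P : U × X → ℝ) : ℝ :=
  -∑ u, ∑ x, P (u, x) * Real.logb 2 (P (u, x) / marginalU P u)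

/-- `I(X;Y|U)_P` for the Markov chain `U - X - Y` given by `P` and the channel. -/
def condMutualInfo {U X Y : Type*} [Fintype U] [Fintype X] [MeasurableSpace Y]
    (W : X → Measure Y) (P : U × X → ℝ) : ℝ :=
  ∑ u, marginalU P u * mutualInfo W (condX P u)

/-- `H(X|YU)_P` for the Markov chain `U - X - Y` given by `P` and the channel. -/
def condEquivocation {U X Y : Type*} [Fintype U] [Fintype X] [MeasurableSpace Y]
    (W : X → Measure Y) (P : U × X → ℝ) : ℝ :=
  ∑ u, marginalU P u * equivocation W (condX P u)

/-! ### The regions given by information quantities -/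

/-- The region `𝒞`; a triple is written `R = (R₁, R₂, R₃)`. The auxiliary variable `U` takes
values in a finite set of arbitrary size. -/
def regionC {X Y : Type*} [Fintype X] [MeasurableSpace Y] (W : X → Measure Y) :
    Set (ℝ × ℝ × ℝ) :=
  {R | ∃ (k : ℕ) (P : Fin k × X → ℝ), P ∈ stdSimplex ℝ (Fin k × X) ∧
    0 < R.1 - R.2.1 ∧ R.1 - R.2.1 < condMutualInfo W P ∧
    R.2.2 ≤ R.1 - condMutualInfo W P ∧
    R.1 < condEntropy P ∧
    0 < R.1 ∧ 0 < R.2.1 ∧ 0 < R.2.2}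

/-- The region `𝒞ˢ`. -/
def regionCs {X Y : Type*} [Fintype X] [MeasurableSpace Y] (W : X → Measure Y) :
    Set (ℝ × ℝ × ℝ) :=
  {R | ∃ (k : ℕ) (P : Fin k × X → ℝ), P ∈ stdSimplex ℝ (Fin k × X) ∧
    0 < R.1 - R.2.1 ∧ R.1 - R.2.1 < condMutualInfo W P ∧
    R.2.2 ≤ condEquivocation W P ∧
    R.1 < condEntropy P ∧
    0 < R.1 ∧ 0 < R.2.1 ∧ 0 < R.2.2}

/-! ### Codes -/

/-- A list-decoding code with input alphabet `A` and output space `B`: a (possibly stochastic)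
encoder for `M` messages and a decoder that outputs lists of at most `L` messages, where
`1 ≤ L < M`. -/
structure Code (A B : Type*) [MeasurableSpace B] where
  /-- The number of messages. -/
  M : ℕ
  /-- The maximal list size. -/
  L : ℕ
  L_pos : 0 < L
  L_lt_M : L < M
  /-- The encoder: message `m` is sent as a random input with law `enc m`. -/
  enc : Fin M → PMF A
  /-- The decoder: the list that is output when `y` is received. -/
  dec : B → Finset (Fin M)
  card_dec_le : ∀ y, (dec y).card ≤ L
  measurableSet_dec : ∀ m, MeasurableSet {y | m ∈ dec y}

namespace Code

variable {A B : Type*} [MeasurableSpace B]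

/-- The code is deterministic: each message is mapped to one input. -/
def IsDeterministic (c : Code A B) : Prop :=
  ∃ f : Fin c.M → A, ∀ m, c.enc m = PMF.pure (f m)

/-- The probability that the list contains `m` when the output has law `P`
(this is `1 - ε_{A,m}`). -/
def listProb (c : Code A B) (P : Measure B) (m : Fin c.M) : ℝ :=
  P.real {y | m ∈ c.dec y}

/-- The law `W_{φ(m)}` of the output when message `m` is encoded and sent via `V`. -/
def outputLaw [Fintype A] (c : Code A B) (V : A → Measure B) (m : Fin c.M) : Measure B :=
  ∑ a, c.enc m a • V a

/-- The verifiability error `ε_A(φ, D)`. -/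
def epsA [Fintype A] (c : Code A B) (V : A → Measure B) : ℝ :=
  ⨆ m, (1 - c.listProb (c.outputLaw V m) m)

/-- The binding parameter `δ_C(φ, D)` for an honest sender. -/
def deltaC [Fintype A] (c : Code A B) (V : A → Measure B) : ℝ :=
  ⨆ m, ⨆ m' : {m' // m' ≠ m}, c.listProb (c.outputLaw V m) m'

/-- The second largest value (counted with multiplicity) of the probabilities, over the messages
`m`, that the list contains `m` when the input is `a`. -/
def deltaDAt (c : Code A B) (V : A → Measure B) (a : A) : ℝ :=
  ⨆ p : {p : Fin c.M × Fin c.M // p.1 ≠ p.2},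
    min (c.listProb (V a) p.1.1) (c.listProb (V a) p.1.2)

/-- The binding parameter `δ_D(D)` for a dishonest sender, who may use any input. -/
def deltaD (c : Code A B) (V : A → Measure B) : ℝ :=
  ⨆ a, c.deltaDAt V a

/-- The equivocation `E(φ) = log M - min_Q (1/M) ∑ m, D(W_{φ(m)} ‖ Q)`. -/
def equiv [Fintype A] (c : Code A B) (V : A → Measure B) : ℝ :=
  Real.logb 2 c.M -
    (⨅ Q : ProbabilityMeasure B,
      ∑ m, (c.M : ℝ≥0∞)⁻¹ * divergence (c.outputLaw V m) (Q : Measure B)).toReal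

end Code

/-! ### Achievable rate triples -/

/-- The `n`-fold discrete memoryless extension of the channel `W`. -/
def memoryless {X Y : Type*} [MeasurableSpace Y] (W : X → Measure Y) (n : ℕ)
    (x : Fin n → X) : Measure (Fin n → Y) :=
  Measure.pi fun i => W (x i)

section Achievable

variable {X Y : Type*} [Fintype X] [MeasurableSpace Y]

/-- Both the verifiability error and the binding parameter for an honest sender vanish. -/
def WeaklySecure (W : X → Measure Y) (c : ∀ n : ℕ, Code (Fin n → X) (Fin n → Y)) : Prop :=
  Tendsto (fun n => (c n).epsA (memoryless W n)) atTop (𝓝 0) ∧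
    Tendsto (fun n => (c n).deltaC (memoryless W n)) atTop (𝓝 0)

/-- Both the verifiability error and the binding parameter for a dishonest sender vanish. -/
def StronglySecure (W : X → Measure Y) (c : ∀ n : ℕ, Code (Fin n → X) (Fin n → Y)) : Prop :=
  Tendsto (fun n => (c n).epsA (memoryless W n)) atTop (𝓝 0) ∧
    Tendsto (fun n => (c n).deltaD (memoryless W n)) atTop (𝓝 0)

/-- The sequence of codes has message rate `R₁`, list rate `R₂` and asymptotic equivocation rate at
least `R₃`, that is, `liminf E(φ_n)/n ≥ R₃`; rates are nonnegative. -/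
def HasRates (W : X → Measure Y) (c : ∀ n : ℕ, Code (Fin n → X) (Fin n → Y))
    (R : ℝ × ℝ × ℝ) : Prop :=
  (0 ≤ R.1 ∧ 0 ≤ R.2.1 ∧ 0 ≤ R.2.2) ∧
  Tendsto (fun n => Real.logb 2 (c n).M / n) atTop (𝓝 R.1) ∧
  Tendsto (fun n => Real.logb 2 (c n).L / n) atTop (𝓝 R.2.1) ∧
  ∀ ε > 0, ∀ᶠ n : ℕ in atTop, R.2.2 - ε ≤ (c n).equiv (memoryless W n) / n

/-- The weakly deterministically achievable rate triples. -/
def regionWD (W : X → Measure Y) : Set (ℝ × ℝ × ℝ) :=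
  {R | ∃ c : ∀ n : ℕ, Code (Fin n → X) (Fin n → Y),
    (∀ n, (c n).IsDeterministic) ∧ WeaklySecure W c ∧ HasRates W c R}

/-- The strongly deterministically achievable rate triples. -/
def regionSD (W : X → Measure Y) : Set (ℝ × ℝ × ℝ) :=
  {R | ∃ c : ∀ n : ℕ, Code (Fin n → X) (Fin n → Y),
    (∀ n, (c n).IsDeterministic) ∧ StronglySecure W c ∧ HasRates W c R}

/-- The strongly stochastically achievable rate triples. -/
def regionSS (W : X → Measure Y) : Set (ℝ × ℝ × ℝ) :=
  {R | ∃ c : ∀ n : ℕ, Code (Fin n → X) (Fin n → Y),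
    StronglySecure W c ∧ HasRates W c R}

/-- The channel is noiseless: there are at least two inputs, and the output determines the input
perfectly, since the output distributions of distinct inputs are mutually singular. -/
def Noiseless (W : X → Measure Y) : Prop :=
  Nontrivial X ∧ Pairwise fun x x' => W x ⟂ₘ W x'

end Achievable

end SecureListDecoding

end

/-! Let M be a uniform message, X the channel input of block length n and Y the output. Three facts
about a single code carry the converse. Fano's inequality for lists (`le_densInfo_msgDens`) makes
I(M;Y) at least nearly log M − log L. The average divergence to any Q is at least I(M;Y), so the
equivocation is at most log M − I(M;Y) (`equiv_mul_log_le`). Security makes M almost a function of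
X, so H(M|X) is o(n) (`log_add_natEntropy_le`): under strong security no input can make two messages
likely to be listed, and under weak security a deterministic encoder must be injective. The last
fact gives log M ≤ H(X) + o(n). Since I(M;Y) = I(X;Y) − I(X;Y|M) and I(X;Y|M) ≤ H(X|M), the
equivocation is at most log M + H(X|M) − I(X;Y) = H(X) + H(M|X) − I(X;Y). For deterministic codes
H(X|M) = 0, which leaves log M − I(X;Y). A parameter κ in {0, 1} treats both bounds together
(`exists_inputLaw_bounds`).

Mutual information enters these bounds with both signs, so single-letterization must reproduce it
exactly (`exists_infoSet_eq`). A trivial U with the marginals of X gives too much information, and U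
equal to the past inputs gives too little; neither loses entropy. A time-sharing mixture of the two
has exactly the right information.

The limiting triple satisfies the constraints only approximately. If the channel is not noiseless
and a secure code exists, some law has 0 < I(X;Y|U) < H(X|U) (`exists_interior`). Mixing in a little
of this point makes all constraints strict (`mem_closure_of_approx`), hence the closures.

Analytically, everything is reduced to densities with values in [0,1] with respect to the finite
measure ∑ W x (`exists_isDensity`), for which all entropies are finite. -/

noncomputable section
namespace SecureListDecoding
open Real (negMulLog)

/-! ### Entropy of finite distributions, in nats -/

/-- Shannon entropy in nats. -/
def natEntropy {A : Type*} [Fintype A] (p : A → ℝ) : ℝ := ∑ a, negMulLog (p a)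

/-- Each logarithm only grows when its argument is replaced by the whole sum. Applied to c a = p a *
f a y, this is nonnegativity of the posterior entropy at y. -/
lemma negMulLog_sum_le {A : Type*} (s : Finset A) (c : A → ℝ) (hc : ∀ a ∈ s, 0 ≤ c a) :
    negMulLog (∑ a ∈ s, c a) ≤ ∑ a ∈ s, negMulLog (c a) := by
  have h : ∀ a ∈ s, -(c a * Real.log (∑ a ∈ s, c a)) ≤ negMulLog (c a) := by
    intro a ha
    rcases (hc a ha).eq_or_lt with h0 | h0
    · simp [← h0]
    · have := Real.log_le_log h0 (Finset.single_le_sum hc ha)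
      rw [negMulLog, neg_mul]
      nlinarith
  calc negMulLog (∑ a ∈ s, c a) = ∑ a ∈ s, -(c a * Real.log (∑ a ∈ s, c a)) := by
        rw [Finset.sum_neg_distrib, ← Finset.sum_mul, negMulLog, neg_mul]
    _ ≤ _ := Finset.sum_le_sum h

lemma sum_mul_negMulLog_le {A : Type*} [Fintype A] {p : A → ℝ} (hp : p ∈ stdSimplex ℝ A)
    {x : A → ℝ} (hx : ∀ a, 0 ≤ x a) :
    ∑ a, p a * negMulLog (x a) ≤ negMulLog (∑ a, p a * x a) := by
  simpa using Real.concaveOn_negMulLog.le_map_sum (t := Finset.univ) (w := p) (p := x)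
    (fun a _ => hp.1 a) hp.2 (fun a _ => hx a)

/-- The log-sum inequality. -/
lemma logSum_le_negMulLog {A : Type*} [Fintype A] {c g : A → ℝ} (hc : ∀ a, 0 ≤ c a)
    (hg : ∀ a, 0 ≤ g a) :
    -((∑ a, c a * g a) * Real.log (∑ a, c a)) + ∑ a, c a * negMulLog (g a) ≤
      negMulLog (∑ a, c a * g a) := by
  set s := ∑ a, c a with hs
  rcases (Finset.sum_nonneg fun a _ => hc a : 0 ≤ ∑ a, c a).eq_or_lt with h0 | h0
  · have hz : ∀ a, c a = 0 := fun a =>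
      (Finset.sum_eq_zero_iff_of_nonneg fun a _ => hc a).1 h0.symm a (Finset.mem_univ a)
    simp [hz]
  · replace h0 : 0 < s := h0
    have hsimp : (fun a => c a / s) ∈ stdSimplex ℝ A :=
      ⟨fun a => div_nonneg (hc a) h0.le, by rw [← Finset.sum_div, ← hs, div_self h0.ne']⟩
    have key := sum_mul_negMulLog_le hsimp hg
    have e1 : ∑ a, c a / s * g a = (∑ a, c a * g a) / s := by
      rw [Finset.sum_div]; exact Finset.sum_congr rfl fun a _ => by ring
    have e2 : ∑ a, c a / s * negMulLog (g a) = (∑ a, c a * negMulLog (g a)) / s := by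
      rw [Finset.sum_div]; exact Finset.sum_congr rfl fun a _ => by ring
    -- The product rule for `negMulLog` undoes the normalization of the weights by s.
    have e3 : negMulLog (∑ a, c a * g a) =
        (∑ a, c a * g a) / s * negMulLog s + s * negMulLog ((∑ a, c a * g a) / s) := by
      rw [← Real.negMulLog_mul, mul_div_cancel₀ _ h0.ne']
    rw [e1, e2, div_le_iff₀ h0] at key
    have e4 : (∑ a, c a * g a) / s * negMulLog s = -((∑ a, c a * g a) * Real.log s) := by
      rw [negMulLog, neg_mul, mul_neg, ← mul_assoc, div_mul_cancel₀ _ h0.ne']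
    rw [e3, e4]
    linarith

/-- Gibbs' inequality, pointwise. -/
lemma negMulLog_le_cross {x t : ℝ} (hx : 0 ≤ x) (ht : 0 ≤ t) (h : t = 0 → x = 0) :
    negMulLog x ≤ -(x * Real.log t) + t - x := by
  rcases hx.eq_or_lt with h0 | h0
  · simp [← h0, ht]
  · have ht' : 0 < t := ht.lt_of_ne fun h' => h0.ne' (h h'.symm)
    -- The correction t − x cancels once both sides are summed over two probability laws.
    have := Real.log_le_sub_one_of_pos (div_pos ht' h0)
    rw [Real.log_div ht'.ne' h0.ne'] at this
    have h2 : x * (Real.log t - Real.log x) ≤ x * (t / x - 1) := by gcongr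
    have h3 : x * (t / x - 1) = t - x := by field_simp
    rw [negMulLog]
    linarith

lemma natEntropy_nonneg {A : Type*} [Fintype A] {p : A → ℝ} (hp : p ∈ stdSimplex ℝ A) :
    0 ≤ natEntropy p :=
  Finset.sum_nonneg fun a _ => Real.negMulLog_nonneg (hp.1 a) (mem_Icc_of_mem_stdSimplex hp a).2

/-- The product rule of `negMulLog` holds for all reals, so neither positivity nor a treatment of
null values of a is needed. -/
lemma natEntropy_chain {A B : Type*} [Fintype A] [Fintype B] {p : A × B → ℝ} {r : A → ℝ}
    {q : A → B → ℝ} (hp : ∀ a b, p (a, b) = r a * q a b) (hq : ∀ a, ∑ b, q a b = 1) :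
    natEntropy p = natEntropy r + ∑ a, r a * natEntropy (q a) := by
  simp only [natEntropy, Fintype.sum_prod_type, hp, Real.negMulLog_mul, Finset.sum_add_distrib,
    ← Finset.sum_mul, hq, one_mul, ← Finset.mul_sum]

lemma natEntropy_prod_le {A B : Type*} [Fintype A] [Fintype B] {p : A × B → ℝ}
    (hp : p ∈ stdSimplex ℝ (A × B)) :
    natEntropy p ≤ natEntropy (fun a => ∑ b, p (a, b)) + natEntropy (fun b => ∑ a, p (a, b)) := by
  set r : A → ℝ := fun a => ∑ b, p (a, b) with hr
  set s : B → ℝ := fun b => ∑ a, p (a, b) with hs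
  have hrsum : ∑ a, r a = 1 := by rw [← hp.2, Fintype.sum_prod_type]
  have hssum : ∑ b, s b = 1 := by rw [← hp.2, Fintype.sum_prod_type_right]
  have hr0 : ∀ a, 0 ≤ r a := fun a => Finset.sum_nonneg fun b _ => hp.1 _
  have hs0 : ∀ a, 0 ≤ s a := fun a => Finset.sum_nonneg fun b _ => hp.1 _
  have hpr : ∀ a b, p (a, b) ≤ r a := fun a b =>
    Finset.single_le_sum (f := fun b => p (a, b)) (fun b _ => hp.1 _) (Finset.mem_univ b)
  have hps : ∀ a b, p (a, b) ≤ s b := fun a b =>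
    Finset.single_le_sum (f := fun a => p (a, b)) (fun b _ => hp.1 _) (Finset.mem_univ a)
  -- Gibbs' inequality against the product of the marginals.
  have key : ∀ a b, negMulLog (p (a, b)) ≤
      -(p (a, b) * Real.log (r a)) - p (a, b) * Real.log (s b) + r a * s b - p (a, b) := by
    intro a b
    rcases (hp.1 (a, b)).eq_or_lt with h0 | h0
    · simp [← h0, mul_nonneg (hr0 a) (hs0 b)]
    · have h1 := h0.trans_le (hpr a b)
      have h2 := h0.trans_le (hps a b)
      have := negMulLog_le_cross h0.le (mul_pos h1 h2).le fun h => absurd h (mul_pos h1 h2).ne'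
      rw [Real.log_mul h1.ne' h2.ne'] at this
      linarith
  calc natEntropy p = ∑ a, ∑ b, negMulLog (p (a, b)) := by
        rw [natEntropy, Fintype.sum_prod_type]
    _ ≤ ∑ a, ∑ b, (-(p (a, b) * Real.log (r a)) - p (a, b) * Real.log (s b) + r a * s b
          - p (a, b)) := Finset.sum_le_sum fun a _ => Finset.sum_le_sum fun b _ => key a b
    _ = natEntropy r + natEntropy s := by
        simp only [Finset.sum_sub_distrib, Finset.sum_add_distrib, Finset.sum_neg_distrib]
        have e1 : ∑ a, ∑ b, p (a, b) * Real.log (r a) = - natEntropy r := by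
          simp only [natEntropy, negMulLog, ← Finset.sum_mul, neg_mul, Finset.sum_neg_distrib,
            neg_neg]
          rfl
        have e2 : ∑ a, ∑ b, p (a, b) * Real.log (s b) = - natEntropy s := by
          rw [Finset.sum_comm]
          simp only [natEntropy, negMulLog, ← Finset.sum_mul, neg_mul, Finset.sum_neg_distrib,
            neg_neg]
          rfl
        have e3 : ∑ a, ∑ b, r a * s b = 1 := by
          simp only [← Finset.mul_sum, hssum, mul_one, hrsum]
        have e4 : ∑ a, ∑ b, p (a, b) = 1 := hrsum
        rw [e1, e2, e3, e4]; ring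

lemma exists_disintegration {A B : Type*} [Fintype A] [Fintype B] {p : A × B → ℝ}
    (hp : p ∈ stdSimplex ℝ (A × B)) :
    ∃ (r : A → ℝ) (q : A → B → ℝ), r ∈ stdSimplex ℝ A ∧ (∀ a, q a ∈ stdSimplex ℝ B) ∧
      ∀ a b, p (a, b) = r a * q a b := by
  classical
  have hne : Nonempty (A × B) := by
    by_contra h
    rw [not_nonempty_iff] at h
    simpa using hp.2
  obtain ⟨⟨_, b₀⟩⟩ := hne
  have hr0 : ∀ a, 0 ≤ ∑ b, p (a, b) := fun a => Finset.sum_nonneg fun b _ => hp.1 _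
  -- Over a null value of a the conditional law is an arbitrary point mass, so that every q a is a
  -- genuine probability vector.
  refine ⟨fun a => ∑ b, p (a, b), fun a => if ∑ b, p (a, b) = 0 then Pi.single b₀ 1 else
    fun b => p (a, b) / ∑ b, p (a, b), ⟨hr0, by rw [← hp.2, Fintype.sum_prod_type]⟩,
    fun a => ?_, fun a b => ?_⟩
  · dsimp only
    split_ifs with h
    · exact single_mem_stdSimplex ℝ b₀
    · exact ⟨fun b => div_nonneg (hp.1 _) (hr0 a), by rw [← Finset.sum_div, div_self h]⟩
  · dsimp only
    split_ifs with h
    · rw [h, zero_mul]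
      exact (Finset.sum_eq_zero_iff_of_nonneg fun b _ => hp.1 _).1 h b (Finset.mem_univ b)
    · rw [mul_div_cancel₀ _ h]

/-! ### Channels given by bounded densities -/

/-- `f a`, for `a : A`, are probability densities with respect to `μ`, with values in `[0, 1]`. -/
structure IsDensity {A B : Type*} [MeasurableSpace B] (μ : Measure B) (f : A → B → ℝ) :
    Prop where
  meas : ∀ a, Measurable (f a)
  nonneg : ∀ a y, 0 ≤ f a y
  le_one : ∀ a y, f a y ≤ 1
  integral_eq : ∀ a, ∫ y, f a y ∂μ = 1

/-- The differential entropy, in nats, of the density `g` with respect to `μ`. -/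
def densEntropy {B : Type*} [MeasurableSpace B] (μ : Measure B) (g : B → ℝ) : ℝ :=
  ∫ y, negMulLog (g y) ∂μ

/-- The output density for the input distribution `p`. -/
def mix {A B : Type*} [Fintype A] (p : A → ℝ) (f : A → B → ℝ) (y : B) : ℝ := ∑ a, p a * f a y

/-- The mutual information, in nats, between the input with law `p` and the output. -/
def densInfo {A B : Type*} [Fintype A] [MeasurableSpace B] (μ : Measure B) (f : A → B → ℝ)
    (p : A → ℝ) : ℝ :=
  densEntropy μ (mix p f) - ∑ a, p a * densEntropy μ (f a)

lemma integrable_of_abs_le {B : Type*} [MeasurableSpace B] {μ : Measure B} [IsFiniteMeasure μ]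
    {g : B → ℝ} (hg : Measurable g) (C : ℝ) (h : ∀ y, |g y| ≤ C) : Integrable g μ :=
  Integrable.of_bound hg.aestronglyMeasurable C (ae_of_all _ h)

/-- This is why densities are required to lie in [0,1]: entropy integrands are then bounded, hence
integrable for a finite measure. -/
lemma abs_negMulLog_le {x : ℝ} (h0 : 0 ≤ x) (h1 : x ≤ 1) : |negMulLog x| ≤ 1 := by
  rw [abs_of_nonneg (Real.negMulLog_nonneg h0 h1)]
  exact (Real.negMulLog_le_one_sub_self h0).trans (by linarith)

lemma integrable_negMulLog {B : Type*} [MeasurableSpace B] {μ : Measure B} [IsFiniteMeasure μ]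
    {g : B → ℝ} (hg : Measurable g) (h0 : ∀ y, 0 ≤ g y) (h1 : ∀ y, g y ≤ 1) :
    Integrable (fun y => negMulLog (g y)) μ :=
  integrable_of_abs_le (Real.continuous_negMulLog.measurable.comp hg) 1
    fun y => abs_negMulLog_le (h0 y) (h1 y)

section
variable {A B : Type*} [MeasurableSpace B] {μ : Measure B} {f : A → B → ℝ}

lemma IsDensity.integrable [IsFiniteMeasure μ] (hf : IsDensity μ f) (a : A) :
    Integrable (f a) μ :=
  integrable_of_abs_le (hf.meas a) 1 fun y => by
    rw [abs_of_nonneg (hf.nonneg a y)]; exact hf.le_one a y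

lemma IsDensity.integrable_negMulLog [IsFiniteMeasure μ] (hf : IsDensity μ f) (a : A) :
    Integrable (fun y => negMulLog (f a y)) μ :=
  SecureListDecoding.integrable_negMulLog (hf.meas a) (hf.nonneg a) (hf.le_one a)

/-- Mixtures of bounded densities are bounded densities. -/
lemma IsDensity.mix [IsFiniteMeasure μ] [Fintype A] (hf : IsDensity μ f) {C : Type*}
    {q : C → A → ℝ} (hq : ∀ c, q c ∈ stdSimplex ℝ A) :
    IsDensity μ (fun c => mix (q c) f) where
  meas c := by
    unfold SecureListDecoding.mix
    exact Finset.measurable_fun_sum _ fun a _ => (hf.meas a).const_mul _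
  nonneg c y := Finset.sum_nonneg fun a _ => mul_nonneg ((hq c).1 a) (hf.nonneg a y)
  le_one c y := by
    calc _ ≤ ∑ a, q c a * 1 := Finset.sum_le_sum fun a _ =>
          mul_le_mul_of_nonneg_left (hf.le_one a y) ((hq c).1 a)
      _ = 1 := by simpa using (hq c).2
  integral_eq c := by
    unfold SecureListDecoding.mix
    rw [integral_finsetSum _ fun a _ => (hf.integrable a).const_mul _]
    simp [integral_const_mul, hf.integral_eq, (hq c).2]

lemma IsDensity.mix_one [IsFiniteMeasure μ] [Fintype A] (hf : IsDensity μ f)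
    {p : A → ℝ} (hp : p ∈ stdSimplex ℝ A) :
    IsDensity μ (fun _ : Unit => SecureListDecoding.mix p f) := hf.mix fun _ => hp

lemma densInfo_nonneg [IsFiniteMeasure μ] [Fintype A] (hf : IsDensity μ f) {p : A → ℝ}
    (hp : p ∈ stdSimplex ℝ A) : 0 ≤ densInfo μ f p := by
  rw [densInfo, sub_nonneg]
  simp only [densEntropy, ← integral_const_mul]
  rw [← integral_finsetSum _ fun a _ => (hf.integrable_negMulLog a).const_mul _]
  exact integral_mono (integrable_finsetSum _ fun a _ => (hf.integrable_negMulLog a).const_mul _)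
    ((hf.mix_one hp).integrable_negMulLog ())
    fun y => sum_mul_negMulLog_le hp fun a => hf.nonneg a y

/-- The equivocation as an integral. -/
lemma natEntropy_sub_densInfo [IsFiniteMeasure μ] [Fintype A] (hf : IsDensity μ f) {p : A → ℝ}
    (hp : p ∈ stdSimplex ℝ A) :
    natEntropy p - densInfo μ f p =
      ∫ y, (∑ a, negMulLog (p a * f a y) - negMulLog (∑ a, p a * f a y)) ∂μ := by
  have hi : ∀ a ∈ Finset.univ, Integrable (fun y => negMulLog (p a * f a y)) μ := fun a _ =>
    integrable_negMulLog ((hf.meas a).const_mul _) (fun y => mul_nonneg (hp.1 a) (hf.nonneg a y))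
      fun y => mul_le_one₀ (mem_Icc_of_mem_stdSimplex hp a).2 (hf.nonneg a y) (hf.le_one a y)
  have hm : Integrable (fun y => negMulLog (∑ a, p a * f a y)) μ :=
    (hf.mix_one hp).integrable_negMulLog ()
  rw [integral_sub (integrable_finsetSum _ hi) hm, integral_finsetSum _ hi]
  have : ∀ a, ∫ y, negMulLog (p a * f a y) ∂μ =
      negMulLog (p a) + p a * densEntropy μ (f a) := by
    intro a
    simp only [Real.negMulLog_mul]
    rw [integral_add ((hf.integrable a).mul_const _) ((hf.integrable_negMulLog a).const_mul _),
      integral_mul_const, hf.integral_eq, one_mul, integral_const_mul, densEntropy]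
  simp only [this, Finset.sum_add_distrib, natEntropy, densInfo]
  unfold densEntropy SecureListDecoding.mix
  ring

/-- The difference H(X) − I(X;Y) = H(X|Y) is the integral of a pointwise nonnegative function. -/
lemma densInfo_le_natEntropy [IsFiniteMeasure μ] [Fintype A] (hf : IsDensity μ f) {p : A → ℝ}
    (hp : p ∈ stdSimplex ℝ A) : densInfo μ f p ≤ natEntropy p := by
  rw [← sub_nonneg, natEntropy_sub_densInfo hf hp]
  exact integral_nonneg fun y => sub_nonneg.2
    (negMulLog_sum_le _ _ fun a _ => mul_nonneg (hp.1 a) (hf.nonneg a y))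

end

/-! ### Products -/

section
variable {A₁ A₂ B₁ B₂ : Type*} [MeasurableSpace B₁] [MeasurableSpace B₂]
  {μ : Measure B₁} {ν : Measure B₂} {f : A₁ → B₁ → ℝ} {g : A₂ → B₂ → ℝ}

/-- The densities of the product channel. -/
def prodDens (f : A₁ → B₁ → ℝ) (g : A₂ → B₂ → ℝ) (a : A₁ × A₂) (y : B₁ × B₂) : ℝ :=
  f a.1 y.1 * g a.2 y.2

lemma IsDensity.prod [IsFiniteMeasure μ] [IsFiniteMeasure ν] (hf : IsDensity μ f)
    (hg : IsDensity ν g) : IsDensity (μ.prod ν) (prodDens f g) where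
  meas a := ((hf.meas _).comp measurable_fst).mul ((hg.meas _).comp measurable_snd)
  nonneg a y := mul_nonneg (hf.nonneg _ _) (hg.nonneg _ _)
  le_one a y := mul_le_one₀ (hf.le_one _ _) (hg.nonneg _ _) (hg.le_one _ _)
  integral_eq a := by
    unfold prodDens
    rw [integral_prod_mul, hf.integral_eq, hg.integral_eq, one_mul]

lemma densEntropy_mul [IsFiniteMeasure μ] [IsFiniteMeasure ν] (hf : IsDensity μ f)
    (hg : IsDensity ν g) (a : A₁) (b : A₂) :
    densEntropy (μ.prod ν) (prodDens f g (a, b)) = densEntropy μ (f a) + densEntropy ν (g b) := by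
  simp only [densEntropy, prodDens, Real.negMulLog_mul]
  have h1 := (hf.integrable_negMulLog a).mul_prod (hg.integrable b)
  have h2 := (hf.integrable a).mul_prod (hg.integrable_negMulLog b)
  have e : ∀ z : B₁ × B₂, g b z.2 * negMulLog (f a z.1) = negMulLog (f a z.1) * g b z.2 :=
    fun z => mul_comm _ _
  simp only [e]
  rw [integral_add h1 h2, integral_prod_mul (fun y => negMulLog (f a y)) (g b),
    integral_prod_mul (f a) (fun y => negMulLog (g b y)), hf.integral_eq, hg.integral_eq]
  ring

lemma sum_densEntropy_prodDens [IsFiniteMeasure μ] [IsFiniteMeasure ν] [Fintype A₁] [Fintype A₂]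
    (hf : IsDensity μ f) (hg : IsDensity ν g) (p : A₁ × A₂ → ℝ) :
    ∑ a, p a * densEntropy (μ.prod ν) (prodDens f g a) =
      ∑ a, (∑ b, p (a, b)) * densEntropy μ (f a) + ∑ b, (∑ a, p (a, b)) * densEntropy ν (g b) := by
  rw [Fintype.sum_prod_type]
  simp only [densEntropy_mul hf hg, mul_add, Finset.sum_add_distrib, Finset.sum_mul]
  rw [Finset.sum_comm (f := fun a b => p (a, b) * densEntropy ν (g b))]

lemma marginal_fst_mem {A₁ A₂ : Type*} [Fintype A₁] [Fintype A₂] {p : A₁ × A₂ → ℝ}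
    (hp : p ∈ stdSimplex ℝ (A₁ × A₂)) : (fun a => ∑ b, p (a, b)) ∈ stdSimplex ℝ A₁ :=
  ⟨fun a => Finset.sum_nonneg fun b _ => hp.1 _, by rw [← hp.2, Fintype.sum_prod_type]⟩

lemma marginal_snd_mem {A₁ A₂ : Type*} [Fintype A₁] [Fintype A₂] {p : A₁ × A₂ → ℝ}
    (hp : p ∈ stdSimplex ℝ (A₁ × A₂)) : (fun b => ∑ a, p (a, b)) ∈ stdSimplex ℝ A₂ :=
  ⟨fun a => Finset.sum_nonneg fun b _ => hp.1 _, by rw [← hp.2, Fintype.sum_prod_type_right]⟩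

/-- The other factor is at most one. The bound serves twice: the joint density vanishes wherever its
marginal does, and its product with the logarithm of the marginal stays bounded. -/
lemma mix_prodDens_le_fst [Fintype A₁] [Fintype A₂] (hf : IsDensity μ f)
    (hg : IsDensity ν g) {p : A₁ × A₂ → ℝ} (hp : p ∈ stdSimplex ℝ (A₁ × A₂)) (z : B₁ × B₂) :
    mix p (prodDens f g) z ≤ mix (fun a => ∑ b, p (a, b)) f z.1 := by
  simp only [mix, Fintype.sum_prod_type, Finset.sum_mul, prodDens]
  refine Finset.sum_le_sum fun a _ => Finset.sum_le_sum fun b _ => ?_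
  exact mul_le_mul_of_nonneg_left (mul_le_of_le_one_right (hf.nonneg _ _) (hg.le_one _ _)) (hp.1 _)

lemma mix_prodDens_le_snd [Fintype A₁] [Fintype A₂] (hf : IsDensity μ f)
    (hg : IsDensity ν g) {p : A₁ × A₂ → ℝ} (hp : p ∈ stdSimplex ℝ (A₁ × A₂)) (z : B₁ × B₂) :
    mix p (prodDens f g) z ≤ mix (fun b => ∑ a, p (a, b)) g z.2 := by
  simp only [mix, Fintype.sum_prod_type_right, Finset.sum_mul, prodDens]
  refine Finset.sum_le_sum fun a _ => Finset.sum_le_sum fun b _ => ?_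
  exact mul_le_mul_of_nonneg_left (mul_le_of_le_one_left (hg.nonneg _ _) (hf.le_one _ _)) (hp.1 _)

omit [MeasurableSpace B₁] in
lemma integral_mix_prodDens_snd [Fintype A₁] [Fintype A₂] [IsFiniteMeasure ν]
    (hg : IsDensity ν g) (p : A₁ × A₂ → ℝ) (y : B₁) :
    ∫ z, mix p (prodDens f g) (y, z) ∂ν = mix (fun a => ∑ b, p (a, b)) f y := by
  simp only [mix, prodDens, ← mul_assoc]
  rw [integral_finsetSum _ fun a _ => (hg.integrable _).const_mul _]
  simp only [integral_const_mul, hg.integral_eq, mul_one, Fintype.sum_prod_type, Finset.sum_mul]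

omit [MeasurableSpace B₂] in
lemma integral_mix_prodDens_fst [Fintype A₁] [Fintype A₂] [IsFiniteMeasure μ]
    (hf : IsDensity μ f) (p : A₁ × A₂ → ℝ) (z : B₂) :
    ∫ y, mix p (prodDens f g) (y, z) ∂μ = mix (fun b => ∑ a, p (a, b)) g z := by
  simp only [mix, prodDens, ← mul_assoc, mul_right_comm _ _ (g _ z)]
  rw [integral_finsetSum _ fun a _ => (hf.integrable _).const_mul _]
  simp only [integral_const_mul, hf.integral_eq, mul_one, Fintype.sum_prod_type_right,
    Finset.sum_mul]

lemma abs_mul_log_le {x u : ℝ} (hx : 0 ≤ x) (hxu : x ≤ u) (hu : u ≤ 1) :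
    |x * Real.log u| ≤ 1 := by
  have h0 := hx.trans hxu
  rw [abs_mul, abs_of_nonneg hx]
  calc x * |Real.log u| ≤ u * |Real.log u| := by gcongr
    _ = |negMulLog u| := by rw [negMulLog, abs_mul, abs_neg, abs_of_nonneg h0]
    _ ≤ 1 := abs_negMulLog_le h0 hu

lemma integrable_mix_log_fst [Fintype A₁] [Fintype A₂] [IsFiniteMeasure μ] [IsFiniteMeasure ν]
    (hf : IsDensity μ f) (hg : IsDensity ν g) {p : A₁ × A₂ → ℝ}
    (hp : p ∈ stdSimplex ℝ (A₁ × A₂)) :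
    Integrable (fun z => mix p (prodDens f g) z *
      Real.log (mix (fun a => ∑ b, p (a, b)) f z.1)) (μ.prod ν) := by
  have hF := (hf.prod hg).mix_one hp
  have hu := hf.mix_one (marginal_fst_mem hp)
  exact integrable_of_abs_le ((hF.meas ()).mul
    (Real.measurable_log.comp ((hu.meas ()).comp measurable_fst))) 1 fun z =>
    abs_mul_log_le (hF.nonneg () z) (mix_prodDens_le_fst hf hg hp z) (hu.le_one () _)

lemma integral_mix_log_fst [Fintype A₁] [Fintype A₂] [IsFiniteMeasure μ] [IsFiniteMeasure ν]
    (hf : IsDensity μ f) (hg : IsDensity ν g) {p : A₁ × A₂ → ℝ}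
    (hp : p ∈ stdSimplex ℝ (A₁ × A₂)) :
    ∫ z, mix p (prodDens f g) z * Real.log (mix (fun a => ∑ b, p (a, b)) f z.1) ∂(μ.prod ν) =
      -densEntropy μ (mix (fun a => ∑ b, p (a, b)) f) := by
  rw [integral_prod _ (integrable_mix_log_fst hf hg hp)]
  simp only [integral_mul_const, integral_mix_prodDens_snd hg, densEntropy, negMulLog, neg_mul,
    integral_neg, neg_neg]

lemma integrable_mix_log_snd [Fintype A₁] [Fintype A₂] [IsFiniteMeasure μ] [IsFiniteMeasure ν]
    (hf : IsDensity μ f) (hg : IsDensity ν g) {p : A₁ × A₂ → ℝ}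
    (hp : p ∈ stdSimplex ℝ (A₁ × A₂)) :
    Integrable (fun z => mix p (prodDens f g) z *
      Real.log (mix (fun b => ∑ a, p (a, b)) g z.2)) (μ.prod ν) := by
  have hF := (hf.prod hg).mix_one hp
  have hu := hg.mix_one (marginal_snd_mem hp)
  exact integrable_of_abs_le ((hF.meas ()).mul
    (Real.measurable_log.comp ((hu.meas ()).comp measurable_snd))) 1 fun z =>
    abs_mul_log_le (hF.nonneg () z) (mix_prodDens_le_snd hf hg hp z) (hu.le_one () _)

lemma integral_mix_log_snd [Fintype A₁] [Fintype A₂] [IsFiniteMeasure μ] [IsFiniteMeasure ν]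
    (hf : IsDensity μ f) (hg : IsDensity ν g) {p : A₁ × A₂ → ℝ}
    (hp : p ∈ stdSimplex ℝ (A₁ × A₂)) :
    ∫ z, mix p (prodDens f g) z * Real.log (mix (fun b => ∑ a, p (a, b)) g z.2) ∂(μ.prod ν) =
      -densEntropy ν (mix (fun b => ∑ a, p (a, b)) g) := by
  rw [integral_prod_symm _ (integrable_mix_log_snd hf hg hp)]
  simp only [integral_mul_const, integral_mix_prodDens_fst hf, densEntropy, negMulLog, neg_mul,
    integral_neg, neg_neg]

/-- Subadditivity of mutual information for a product channel. -/
lemma densInfo_prod_le [Fintype A₁] [Fintype A₂] [IsFiniteMeasure μ] [IsFiniteMeasure ν]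
    (hf : IsDensity μ f) (hg : IsDensity ν g) {p : A₁ × A₂ → ℝ}
    (hp : p ∈ stdSimplex ℝ (A₁ × A₂)) :
    densInfo (μ.prod ν) (prodDens f g) p ≤
      densInfo μ f (fun a => ∑ b, p (a, b)) + densInfo ν g (fun b => ∑ a, p (a, b)) := by
  have hF := (hf.prod hg).mix_one hp
  have hu := hf.mix_one (marginal_fst_mem hp)
  have hv := hg.mix_one (marginal_snd_mem hp)
  set F := mix p (prodDens f g) with hFdef
  set u := mix (fun a => ∑ b, p (a, b)) f with hudef
  set v := mix (fun b => ∑ a, p (a, b)) g with hvdef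
  -- The output entropies given the inputs add up exactly, so only h(Y₁Y₂) ≤ h(Y₁) + h(Y₂) is
  -- needed; it is Gibbs' inequality against the product of the output marginals.
  have key : ∀ z, negMulLog (F z) ≤
      -(F z * Real.log (u z.1)) - F z * Real.log (v z.2) + (u z.1 * v z.2 - F z) := by
    intro z
    rcases (hF.nonneg () z).eq_or_lt with h0 | h0
    · have := mul_nonneg (hu.nonneg () z.1) (hv.nonneg () z.2)
      simpa [← h0] using this
    · have h1 : 0 < u z.1 := h0.trans_le (mix_prodDens_le_fst hf hg hp z)
      have h2 : 0 < v z.2 := h0.trans_le (mix_prodDens_le_snd hf hg hp z)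
      have := negMulLog_le_cross h0.le (mul_pos h1 h2).le fun h => absurd h (mul_pos h1 h2).ne'
      rw [Real.log_mul h1.ne' h2.ne'] at this
      linarith
  have i1 : Integrable (fun z => -(F z * Real.log (u z.1))) (μ.prod ν) :=
    (integrable_mix_log_fst hf hg hp).neg
  have i2 : Integrable (fun z => F z * Real.log (v z.2)) (μ.prod ν) :=
    integrable_mix_log_snd hf hg hp
  have i3 : Integrable (fun z : B₁ × B₂ => u z.1 * v z.2) (μ.prod ν) :=
    (hu.integrable ()).mul_prod (hv.integrable ())
  have i4 : Integrable (fun z => F z) (μ.prod ν) := hF.integrable ()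
  have i5 : Integrable (fun z => -(F z * Real.log (u z.1)) - F z * Real.log (v z.2)) (μ.prod ν) :=
    i1.sub i2
  have i6 : Integrable (fun z : B₁ × B₂ => u z.1 * v z.2 - F z) (μ.prod ν) := i3.sub i4
  have hmain : densEntropy (μ.prod ν) F ≤ densEntropy μ u + densEntropy ν v := by
    calc densEntropy (μ.prod ν) F ≤ ∫ z, (-(F z * Real.log (u z.1)) - F z * Real.log (v z.2) +
          (u z.1 * v z.2 - F z)) ∂(μ.prod ν) :=
          integral_mono (hF.integrable_negMulLog ()) (i5.add i6) key
      _ = _ := by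
          have e1 := integral_mix_log_fst hf hg hp
          have e2 := integral_mix_log_snd hf hg hp
          rw [integral_add i5 i6, integral_sub i1 i2, integral_sub i3 i4, integral_neg, e1, e2, integral_prod_mul, hu.integral_eq (),
            hv.integral_eq (), hF.integral_eq ()]
          ring
  simp only [densInfo, sum_densEntropy_prodDens hf hg p]
  linarith

/-- Superadditivity of mutual information for a product channel, conditioning on the first
input. -/
lemma le_densInfo_prod [Fintype A₁] [Fintype A₂] [IsFiniteMeasure μ] [IsFiniteMeasure ν]
    (hf : IsDensity μ f) (hg : IsDensity ν g) {p : A₁ × A₂ → ℝ}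
    (hp : p ∈ stdSimplex ℝ (A₁ × A₂)) {r : A₁ → ℝ} {q : A₁ → A₂ → ℝ}
    (hq : ∀ a, q a ∈ stdSimplex ℝ A₂) (hpq : ∀ a b, p (a, b) = r a * q a b) :
    densInfo μ f r + ∑ a, r a * densInfo ν g (q a) ≤ densInfo (μ.prod ν) (prodDens f g) p := by
  have hF := (hf.prod hg).mix_one hp
  have hr : (fun a => ∑ b, p (a, b)) = r := by
    funext a
    simp only [hpq, ← Finset.mul_sum, (hq a).2, mul_one]
  have hr0 : ∀ a, 0 ≤ r a := fun a => by
    rw [← hr]; exact (marginal_fst_mem hp).1 a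
  have hG := hg.mix hq
  have hFeq : ∀ z, mix p (prodDens f g) z = ∑ a, (r a * f a z.1) * mix (q a) g z.2 := by
    intro z
    simp only [mix, Fintype.sum_prod_type, hpq, prodDens, Finset.mul_sum]
    exact Finset.sum_congr rfl fun a _ => Finset.sum_congr rfl fun b _ => by ring
  -- The log-sum inequality with the joint weights of the first input and the first output.
  -- Integrated, it says h(Y₁Y₂) ≥ h(Y₁) + h(Y₂|X₁), because Y₁ depends on Y₂ only through X₁.
  have key : ∀ z, -(mix p (prodDens f g) z * Real.log (mix r f z.1)) +
      ∑ a, (r a * f a z.1) * negMulLog (mix (q a) g z.2) ≤ negMulLog (mix p (prodDens f g) z) := by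
    intro z
    rw [hFeq]
    exact logSum_le_negMulLog (fun a => mul_nonneg (hr0 a) (hf.nonneg a _))
      (fun a => hG.nonneg a _)
  have i1 := integrable_mix_log_fst hf hg hp
  have e1 := integral_mix_log_fst hf hg hp
  rw [hr] at i1 e1
  replace i1 : Integrable (fun z => -(mix p (prodDens f g) z * Real.log (mix r f z.1)))
    (μ.prod ν) := i1.neg
  have i2 : ∀ a ∈ (Finset.univ : Finset A₁), Integrable (fun z : B₁ × B₂ =>
      (r a * f a z.1) * negMulLog (mix (q a) g z.2)) (μ.prod ν) := fun a _ =>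
    ((hf.integrable a).const_mul (r a)).mul_prod (hG.integrable_negMulLog a)
  have e2 : ∀ a, ∫ z : B₁ × B₂, (r a * f a z.1) * negMulLog (mix (q a) g z.2) ∂(μ.prod ν) =
      r a * densEntropy ν (mix (q a) g) := by
    intro a
    rw [integral_prod_mul (fun y => r a * f a y) (fun z => negMulLog (mix (q a) g z)),
      integral_const_mul, hf.integral_eq, mul_one, densEntropy]
  have hmain : densEntropy μ (mix r f) + ∑ a, r a * densEntropy ν (mix (q a) g) ≤
      densEntropy (μ.prod ν) (mix p (prodDens f g)) := by
    refine le_trans (le_of_eq ?_) (integral_mono (i1.add (integrable_finsetSum _ i2))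
      (hF.integrable_negMulLog ()) key)
    simp only [Pi.add_apply]
    rw [integral_add i1 (integrable_finsetSum _ i2), integral_neg, e1, integral_finsetSum _ i2]
    simp only [e2, neg_neg]
  have e3 : ∑ a, r a * ∑ b, q a b * densEntropy ν (g b) =
      ∑ b, (∑ a, p (a, b)) * densEntropy ν (g b) := by
    simp only [hpq, Finset.sum_mul, Finset.mul_sum]
    rw [Finset.sum_comm]
    exact Finset.sum_congr rfl fun a _ => Finset.sum_congr rfl fun b _ => by ring
  have hr' : ∀ a, ∑ b, p (a, b) = r a := fun a => congrFun hr a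
  simp only [densInfo, sum_densEntropy_prodDens hf hg p, mul_sub, Finset.sum_sub_distrib, e3, hr']
  linarith

end

/-! ### Single-letterization -/

/-- The densities of the memoryless extension. -/
def piDens {X Y : Type*} (f : X → Y → ℝ) {n : ℕ} (x : Fin n → X) (y : Fin n → Y) : ℝ :=
  ∏ i, f (x i) (y i)

section
variable {X Y : Type*} [MeasurableSpace Y] {μ : Measure Y} {f : X → Y → ℝ}

lemma IsDensity.pi [IsFiniteMeasure μ] (hf : IsDensity μ f) (n : ℕ) :
    IsDensity (Measure.pi fun _ : Fin n => μ) (piDens f) where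
  meas x := by
    unfold piDens
    exact Finset.measurable_fun_prod _ fun i _ => (hf.meas _).comp (measurable_pi_apply i)
  nonneg x y := Finset.prod_nonneg fun i _ => hf.nonneg _ _
  le_one x y := Finset.prod_le_one (fun i _ => hf.nonneg _ _) fun i _ => hf.le_one _ _
  integral_eq x := by
    unfold piDens
    rw [integral_fintype_prod_eq_prod (fun i y => f (x i) y)]
    simp [hf.integral_eq]

lemma densInfo_congr {A A' B B' : Type*} [Fintype A] [Fintype A'] [MeasurableSpace B]
    [MeasurableSpace B'] {μ : Measure B} {μ' : Measure B'} {f : A → B → ℝ} {f' : A' → B' → ℝ}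
    (e : A' ≃ A) (σ : B ≃ᵐ B') (hσ : MeasurePreserving σ μ μ')
    (h : ∀ a y, f (e a) y = f' a (σ y)) (p : A → ℝ) :
    densInfo μ f p = densInfo μ' f' (fun a => p (e a)) := by
  have h1 : ∀ a, densEntropy μ (f (e a)) = densEntropy μ' (f' a) := by
    intro a
    simp only [densEntropy, h]
    exact hσ.integral_comp' (g := fun y => negMulLog (f' a y))
  have h2 : densEntropy μ (mix p f) = densEntropy μ' (mix (fun a => p (e a)) f') := by
    have : ∀ y, mix p f y = mix (fun a => p (e a)) f' (σ y) := by
      intro y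
      simp only [mix, ← h]
      exact (e.sum_comp fun a => p a * f a y).symm
    simp only [densEntropy, this]
    exact hσ.integral_comp' (g := fun y => negMulLog (mix (fun a => p (e a)) f' y))
  rw [densInfo, densInfo, h2, ← e.sum_comp]
  simp only [h1]

lemma densInfo_piDens_succ [Fintype X] [IsFiniteMeasure μ] {n : ℕ} (p : (Fin (n + 1) → X) → ℝ) :
    densInfo (Measure.pi fun _ : Fin (n + 1) => μ) (piDens f) p =
      densInfo (μ.prod (Measure.pi fun _ : Fin n => μ)) (prodDens f (piDens f))
        (fun a => p (Fin.consEquiv (fun _ => X) a)) := by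
  refine densInfo_congr (Fin.consEquiv (fun _ => X)) _
    (measurePreserving_piFinSuccAbove (fun _ : Fin (n + 1) => μ) 0) (fun a y => ?_) p
  simp [piDens, prodDens, Fin.prod_univ_succ, Fin.consEquiv, Fin.tail]

lemma natEntropy_comp_equiv {A A' : Type*} [Fintype A] [Fintype A'] (e : A' ≃ A) (p : A → ℝ) :
    natEntropy (fun a => p (e a)) = natEntropy p :=
  e.sum_comp fun a => negMulLog (p a)

lemma comp_equiv_mem_stdSimplex {A A' : Type*} [Fintype A] [Fintype A'] (e : A' ≃ A)
    {p : A → ℝ} (hp : p ∈ stdSimplex ℝ A) : (fun a => p (e a)) ∈ stdSimplex ℝ A' :=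
  ⟨fun _ => hp.1 _, by rw [e.sum_comp, hp.2]⟩

/-- The pairs `(I(X;Y|U), H(X|U))`, in nats. -/
def infoSet [Fintype X] (μ : Measure Y) (f : X → Y → ℝ) : Set (ℝ × ℝ) :=
  convexHull ℝ ((fun p => (densInfo μ f p, natEntropy p)) '' stdSimplex ℝ X)

lemma mem_infoSet [Fintype X] {p : X → ℝ} (hp : p ∈ stdSimplex ℝ X) :
    (densInfo μ f p, natEntropy p) ∈ infoSet μ f :=
  subset_convexHull ℝ _ ⟨p, hp, rfl⟩

/-- Combination of one letter and `n` further letters. -/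
lemma exists_mem_convex_succ {s : Set (ℝ × ℝ)} (hs : Convex ℝ s) {v w : ℝ × ℝ} (hv : v ∈ s)
    (hw : w ∈ s) (n : ℕ) : ∃ z ∈ s, (n + 1 : ℝ) * z.1 = v.1 + n * w.1 ∧
      (n + 1 : ℝ) * z.2 = v.2 + n * w.2 := by
  have hn : (0 : ℝ) < n + 1 := by positivity
  refine ⟨(1 / (n + 1 : ℝ)) • v + (n / (n + 1 : ℝ)) • w,
    hs hv hw (by positivity) (by positivity) (by field_simp; ring), ?_, ?_⟩
  · simp only [Prod.fst_add, Prod.smul_fst, smul_eq_mul]; field_simp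
  · simp only [Prod.snd_add, Prod.smul_snd, smul_eq_mul]; field_simp

lemma stdSimplex_unique [Fintype X] {p : (Fin 0 → X) → ℝ} (hp : p ∈ stdSimplex ℝ (Fin 0 → X)) :
    ∀ x, p x = 1 := by
  intro x
  have := hp.2
  rw [Fintype.sum_unique] at this
  rw [← this]; congr; exact Subsingleton.elim _ _

lemma natEntropy_zero [Fintype X] {p : (Fin 0 → X) → ℝ} (hp : p ∈ stdSimplex ℝ (Fin 0 → X)) :
    natEntropy p = 0 := by
  simp [natEntropy, stdSimplex_unique hp]

lemma densInfo_zero [Fintype X] [IsFiniteMeasure μ] (hf : IsDensity μ f) {p : (Fin 0 → X) → ℝ}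
    (hp : p ∈ stdSimplex ℝ (Fin 0 → X)) :
    densInfo (Measure.pi fun _ : Fin 0 => μ) (piDens f) p = 0 :=
  le_antisymm ((densInfo_le_natEntropy (hf.pi 0) hp).trans_eq (natEntropy_zero hp))
    (densInfo_nonneg (hf.pi 0) hp)

lemma infoSet_nonempty [Fintype X] [Nonempty X] : (infoSet μ f).Nonempty := by
  classical
  obtain ⟨x⟩ := ‹Nonempty X›
  exact ⟨_, mem_infoSet (single_mem_stdSimplex ℝ x)⟩

/-- Time sharing over the marginal laws of the letters: both information and entropy are
subadditive. -/
lemma exists_infoSet_ge [Fintype X] [Nonempty X] [IsFiniteMeasure μ] (hf : IsDensity μ f)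
    (n : ℕ) (p : (Fin n → X) → ℝ) (hp : p ∈ stdSimplex ℝ (Fin n → X)) :
    ∃ v ∈ infoSet μ f, densInfo (Measure.pi fun _ : Fin n => μ) (piDens f) p ≤ n * v.1 ∧
      natEntropy p ≤ n * v.2 := by
  induction n with
  | zero =>
    obtain ⟨v, hv⟩ := infoSet_nonempty (μ := μ) (f := f)
    exact ⟨v, hv, by simp [densInfo_zero hf hp], by simp [natEntropy_zero hp]⟩
  | succ n ih =>
    set p' : X × (Fin n → X) → ℝ := fun a => p (Fin.consEquiv (fun _ => X) a) with hp'def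
    have hp' : p' ∈ stdSimplex ℝ (X × (Fin n → X)) := comp_equiv_mem_stdSimplex _ hp
    obtain ⟨w, hw, hw1, hw2⟩ := ih _ (marginal_snd_mem hp')
    obtain ⟨z, hz, hz1, hz2⟩ := exists_mem_convex_succ (convex_convexHull ℝ _)
      (mem_infoSet (μ := μ) (f := f) (marginal_fst_mem hp')) hw n
    refine ⟨z, hz, ?_, ?_⟩
    · rw [densInfo_piDens_succ]
      push_cast
      rw [hz1]
      exact (densInfo_prod_le hf (hf.pi n) hp').trans (by gcongr)
    · rw [← natEntropy_comp_equiv (Fin.consEquiv (fun _ => X)) p]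
      push_cast
      rw [hz2]
      exact (natEntropy_prod_le hp').trans (by gcongr)

/-- Here U carries the past inputs: the entropy chain rule loses nothing, while information is
superadditive under this conditioning. -/
lemma exists_infoSet_le [Fintype X] [Nonempty X] [IsFiniteMeasure μ] (hf : IsDensity μ f)
    (n : ℕ) (p : (Fin n → X) → ℝ) (hp : p ∈ stdSimplex ℝ (Fin n → X)) :
    ∃ v ∈ infoSet μ f, n * v.1 ≤ densInfo (Measure.pi fun _ : Fin n => μ) (piDens f) p ∧
      natEntropy p ≤ n * v.2 := by
  induction n with
  | zero =>
    obtain ⟨v, hv⟩ := infoSet_nonempty (μ := μ) (f := f)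
    exact ⟨v, hv, by simp [densInfo_zero hf hp], by simp [natEntropy_zero hp]⟩
  | succ n ih =>
    set p' : X × (Fin n → X) → ℝ := fun a => p (Fin.consEquiv (fun _ => X) a) with hp'def
    have hp' : p' ∈ stdSimplex ℝ (X × (Fin n → X)) := comp_equiv_mem_stdSimplex _ hp
    obtain ⟨r, q, hr, hq, hpq⟩ := exists_disintegration hp'
    -- One point for the remaining letters per value of the first letter; averaging with r stays in
    -- the hull by convexity.
    choose w hw hw1 hw2 using fun a => ih (q a) (hq a)
    obtain ⟨z, hz, hz1, hz2⟩ := exists_mem_convex_succ (convex_convexHull ℝ _)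
      (mem_infoSet (μ := μ) (f := f) hr)
      ((convex_convexHull ℝ _).sum_mem (fun a _ => hr.1 a) hr.2 fun a _ => hw a) n
    simp only [Prod.fst_sum, Prod.snd_sum, Prod.smul_fst, Prod.smul_snd, smul_eq_mul,
      Finset.mul_sum] at hz1 hz2
    refine ⟨z, hz, ?_, ?_⟩
    · rw [densInfo_piDens_succ]
      push_cast
      rw [hz1]
      refine le_trans ?_ (le_densInfo_prod hf (hf.pi n) hp' hq hpq)
      refine add_le_add le_rfl (Finset.sum_le_sum fun a _ => ?_)
      rw [mul_left_comm]
      exact mul_le_mul_of_nonneg_left (hw1 a) (hr.1 a)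
    · rw [← natEntropy_comp_equiv (Fin.consEquiv (fun _ => X)) p]
      push_cast
      rw [hz2]
      refine (natEntropy_chain hpq fun a => (hq a).2).trans_le ?_
      refine add_le_add le_rfl (Finset.sum_le_sum fun a _ => ?_)
      rw [mul_left_comm]
      exact mul_le_mul_of_nonneg_left (hw2 a) (hr.1 a)

/-- Single-letterization: time sharing between a trivial auxiliary variable and the past inputs
attains the mutual information exactly. -/
lemma exists_infoSet_eq [Fintype X] [Nonempty X] [IsFiniteMeasure μ] (hf : IsDensity μ f)
    (n : ℕ) (p : (Fin n → X) → ℝ) (hp : p ∈ stdSimplex ℝ (Fin n → X)) :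
    ∃ v ∈ infoSet μ f, n * v.1 = densInfo (Measure.pi fun _ : Fin n => μ) (piDens f) p ∧
      natEntropy p ≤ n * v.2 := by
  obtain ⟨v, hv, hv1, hv2⟩ := exists_infoSet_le hf n p hp
  obtain ⟨w, hw, hw1, hw2⟩ := exists_infoSet_ge hf n p hp
  -- The true information lies between those of the two points. As both dominate the entropy, so
  -- does every mixture of them.
  obtain ⟨a, b, ha, hb, hab, h⟩ : densInfo (Measure.pi fun _ : Fin n => μ) (piDens f) p ∈
      segment ℝ (n * v.1) (n * w.1) := by
    rw [segment_eq_Icc (hv1.trans hw1)]; exact ⟨hv1, hw1⟩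
  refine ⟨a • v + b • w, convex_convexHull ℝ _ hv hw ha hb hab, ?_, ?_⟩
  · rw [← h]
    simp only [Prod.fst_add, Prod.smul_fst, smul_eq_mul]; ring
  · simp only [Prod.snd_add, Prod.smul_snd, smul_eq_mul]
    calc natEntropy p = a * natEntropy p + b * natEntropy p := by rw [← add_mul, hab, one_mul]
      _ ≤ a * (n * v.2) + b * (n * w.2) := by gcongr
      _ = _ := by ring

end

/-! ### Densities of measures -/

lemma withDensity_pi {X Y : Type*} [MeasurableSpace Y] {μ : Measure Y} [IsFiniteMeasure μ]
    {f : X → Y → ℝ} (hf : IsDensity μ f) {W : X → Measure Y} [∀ x, IsProbabilityMeasure (W x)]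
    (hW : ∀ x, W x = μ.withDensity fun y => ENNReal.ofReal (f x y)) {n : ℕ} (x : Fin n → X) :
    memoryless W n x =
      (Measure.pi fun _ : Fin n => μ).withDensity fun y => ENNReal.ofReal (piDens f x y) := by
  refine Measure.pi_eq fun s hs => ?_
  have h1 : ∀ i, W (x i) (s i) = ENNReal.ofReal (∫ y, (s i).indicator (f (x i)) y ∂μ) := by
    intro i
    rw [hW, withDensity_apply _ (hs i), integral_indicator (hs i),
      ofReal_integral_eq_lintegral_ofReal (hf.integrable _).integrableOn
        (ae_of_all _ (hf.nonneg _))]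
  have hs' : MeasurableSet (Set.univ.pi s) := MeasurableSet.univ_pi hs
  rw [withDensity_apply _ hs', ← ofReal_integral_eq_lintegral_ofReal
    ((hf.pi n).integrable x).integrableOn (ae_of_all _ ((hf.pi n).nonneg x)),
    ← integral_indicator hs']
  simp only [h1]
  rw [← ENNReal.ofReal_prod_of_nonneg fun i _ => integral_nonneg fun y =>
    Set.indicator_nonneg (fun y _ => hf.nonneg _ y) y,
    ← integral_fintype_prod_eq_prod (fun i y => (s i).indicator (f (x i)) y)]
  congr 2
  funext y
  by_cases hy : y ∈ Set.univ.pi s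
  · rw [Set.indicator_of_mem hy]
    exact Finset.prod_congr rfl fun i _ => (Set.indicator_of_mem (hy i trivial) _).symm
  · rw [Set.indicator_of_notMem hy]
    simp only [Set.mem_pi, Set.mem_univ, forall_const, not_forall] at hy
    obtain ⟨i, hi⟩ := hy
    exact (Finset.prod_eq_zero (Finset.mem_univ i) (Set.indicator_of_notMem hi _)).symm

/-- Each W x is dominated by the sum μ not only in the sense of null sets but setwise, so its
derivative is at most 1 almost everywhere; truncation makes this hold everywhere. -/
lemma exists_isDensity {X Y : Type*} [Fintype X] [MeasurableSpace Y] (W : X → Measure Y)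
    [∀ x, IsProbabilityMeasure (W x)] :
    ∃ (μ : Measure Y) (f : X → Y → ℝ), IsFiniteMeasure μ ∧ IsDensity μ f ∧
      ∀ x, W x = μ.withDensity fun y => ENNReal.ofReal (f x y) := by
  set μ : Measure Y := ∑ x, W x with hμ
  have hle : ∀ x, W x ≤ μ := fun x => by
    intro s
    rw [hμ, Measure.finsetSum_apply]
    exact Finset.single_le_sum (f := fun x => W x s) (fun _ _ => zero_le) (Finset.mem_univ x)
  have hfin : IsFiniteMeasure μ := by rw [hμ]; infer_instance
  set f : X → Y → ℝ := fun x y => min ((W x).rnDeriv μ y).toReal 1 with hf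
  have hone : ∀ x, (W x).rnDeriv μ ≤ᵐ[μ] 1 := fun x => by
    refine ae_le_of_forall_setLIntegral_le_of_sigmaFinite (Measure.measurable_rnDeriv _ _)
      fun s hs _ => ?_
    simp only [Pi.one_apply, lintegral_one, Measure.restrict_apply MeasurableSet.univ,
      Set.univ_inter]
    exact (Measure.setLIntegral_rnDeriv_le s).trans (hle x s)
  have hWf : ∀ x, W x = μ.withDensity fun y => ENNReal.ofReal (f x y) := fun x => by
    conv_lhs => rw [← Measure.withDensity_rnDeriv_eq (W x) μ (hle x).absolutelyContinuous]
    refine withDensity_congr_ae ?_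
    filter_upwards [hone x] with y hy
    have hy' : (W x).rnDeriv μ y ≤ 1 := hy
    have hne : (W x).rnDeriv μ y ≠ ⊤ := (hy'.trans_lt ENNReal.one_lt_top).ne
    have : ((W x).rnDeriv μ y).toReal ≤ 1 := by
      simpa using ENNReal.toReal_mono ENNReal.one_ne_top hy'
    rw [hf]
    simp only [min_eq_left this, ENNReal.ofReal_toReal hne]
  have hm : ∀ x, Measurable (f x) := fun x =>
    (Measure.measurable_rnDeriv _ _).ennreal_toReal.min measurable_const
  have h0 : ∀ x y, 0 ≤ f x y := fun x y => le_min ENNReal.toReal_nonneg zero_le_one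
  refine ⟨μ, f, hfin, ⟨hm, h0, fun x y => min_le_right _ _, fun x => ?_⟩, hWf⟩
  rw [integral_eq_lintegral_of_nonneg_ae (ae_of_all _ (h0 x)) (hm x).aestronglyMeasurable,
    ← setLIntegral_univ, ← withDensity_apply _ MeasurableSet.univ, ← hWf]
  simp

/-! ### Divergences of measures with densities -/

/-- A variational lower bound for the Kullback-Leibler divergence. -/
lemma ofReal_le_klDiv {B : Type*} [MeasurableSpace B] {P Q : Measure B} [IsProbabilityMeasure P]
    [IsProbabilityMeasure Q] {r : B → ℝ} (hr : Measurable r) (hr0 : ∀ y, 0 ≤ r y) (K : ℝ)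
    (hrK : ∀ y, r y ≤ K) (hP : ∀ᵐ y ∂P, r y ≠ 0) (hlog : Integrable (fun y => Real.log (r y)) P) :
    ENNReal.ofReal (∫ y, Real.log (r y) ∂P - ∫ y, r y ∂Q + 1) ≤ klDiv P Q := by
  by_cases htop : klDiv P Q = ⊤
  · simp [htop]
  obtain ⟨hac, hllr⟩ := klDiv_ne_top_iff.1 htop
  rw [klDiv_eq_integral_klFun, if_pos ⟨hac, hllr⟩]
  apply ENNReal.ofReal_le_ofReal
  have hkl := (integrable_klFun_rnDeriv_iff hac).2 hllr
  have hrQ : Integrable r Q := integrable_of_abs_le hr K fun y => by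
    rw [abs_of_nonneg (hr0 y)]; exact hrK y
  have hi : Integrable (fun y => (P.rnDeriv Q y).toReal * Real.log (r y)) Q :=
    (integrable_rnDeriv_smul_iff hac).2 hlog
  -- P has density dP/dQ, so r can vanish only where this density does, up to a Q-null set.
  have hzero : ∀ᵐ y ∂Q, r y = 0 → (P.rnDeriv Q y).toReal = 0 := by
    rw [← Measure.withDensity_rnDeriv_eq P Q hac,
      ae_withDensity_iff (Measure.measurable_rnDeriv P Q)] at hP
    filter_upwards [hP] with y hy h0
    by_contra h
    exact hy (fun h' => h (by simp [h'])) h0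
  have e : ∫ y, Real.log (r y) ∂P = ∫ y, (P.rnDeriv Q y).toReal * Real.log (r y) ∂Q :=
    (integral_rnDeriv_smul hac).symm
  have e1 : ∫ y, Real.log (r y) ∂P - ∫ y, r y ∂Q + 1 =
      ∫ y, ((P.rnDeriv Q y).toReal * Real.log (r y) - r y + 1) ∂Q := by
    have hi2 : Integrable (fun y => (P.rnDeriv Q y).toReal * Real.log (r y) - r y) Q := hi.sub hrQ
    rw [integral_add hi2 (integrable_const _), integral_sub hi hrQ, e]
    simp
  rw [e1]
  refine integral_mono_ae ((hi.sub hrQ).add (integrable_const _)) hkl ?_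
  filter_upwards [hzero] with y hy
  -- Pointwise Gibbs with x = dP/dQ and t = r y is the inequality of the integrands.
  have := negMulLog_le_cross ENNReal.toReal_nonneg (hr0 y) hy
  simp only [klFun_apply]
  rw [negMulLog] at this
  linarith

section
variable {A B : Type*} [Fintype A] [MeasurableSpace B] {μ : Measure B}
  {f : A → B → ℝ} {V : A → Measure B}

lemma outputMeasure_eq (hf : IsDensity μ f)
    (hV : ∀ a, V a = μ.withDensity fun y => ENNReal.ofReal (f a y)) {p : A → ℝ}
    (hp : ∀ a, 0 ≤ p a) :
    outputMeasure V p = μ.withDensity fun y => ENNReal.ofReal (mix p f y) := by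
  ext s hs
  rw [outputMeasure, Measure.finsetSum_apply, withDensity_apply _ hs]
  simp only [mix]
  have : ∀ y, ENNReal.ofReal (∑ a, p a * f a y) =
      ∑ a, ENNReal.ofReal (p a) * ENNReal.ofReal (f a y) := by
    intro y
    rw [ENNReal.ofReal_sum_of_nonneg fun a _ => mul_nonneg (hp a) (hf.nonneg a y)]
    exact Finset.sum_congr rfl fun a _ => ENNReal.ofReal_mul (hp a)
  simp only [this]
  rw [lintegral_finsetSum _ fun a _ => ((hf.meas a).ennreal_ofReal).const_mul _]
  refine Finset.sum_congr rfl fun a _ => ?_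
  rw [lintegral_const_mul _ (hf.meas a).ennreal_ofReal, Measure.smul_apply, smul_eq_mul, hV,
    withDensity_apply _ hs]

lemma integral_withDensity_ofReal {g : B → ℝ} (hg : Measurable g) (h0 : ∀ y, 0 ≤ g y)
    (F : B → ℝ) :
    ∫ y, F y ∂(μ.withDensity fun y => ENNReal.ofReal (g y)) = ∫ y, g y * F y ∂μ := by
  rw [integral_withDensity_eq_integral_toReal_smul hg.ennreal_ofReal
    (ae_of_all _ fun _ => ENNReal.ofReal_lt_top)]
  simp [ENNReal.toReal_ofReal, h0]

lemma integrable_withDensity_ofReal {g : B → ℝ} (hg : Measurable g) (h0 : ∀ y, 0 ≤ g y)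
    {F : B → ℝ} (h : Integrable (fun y => g y * F y) μ) :
    Integrable F (μ.withDensity fun y => ENNReal.ofReal (g y)) := by
  rw [integrable_withDensity_iff_integrable_smul' hg.ennreal_ofReal
    (ae_of_all _ fun _ => ENNReal.ofReal_lt_top)]
  simpa [ENNReal.toReal_ofReal, h0] using h

lemma mul_le_mix (hf : IsDensity μ f) {p : A → ℝ} (hp : ∀ a, 0 ≤ p a) (a : A) (y : B) :
    p a * f a y ≤ mix p f y :=
  Finset.single_le_sum (f := fun a => p a * f a y) (fun a _ => mul_nonneg (hp a) (hf.nonneg a y))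
    (Finset.mem_univ a)

variable [IsFiniteMeasure μ]

omit [Fintype A] in
lemma isProbabilityMeasure_withDensity (hf : IsDensity μ f) (a : A) :
    IsProbabilityMeasure (μ.withDensity fun y => ENNReal.ofReal (f a y)) := by
  refine ⟨?_⟩
  rw [withDensity_apply _ MeasurableSet.univ, setLIntegral_univ,
    ← ofReal_integral_eq_lintegral_ofReal (hf.integrable a) (ae_of_all _ (hf.nonneg a)),
    hf.integral_eq, ENNReal.ofReal_one]

lemma withDensity_div_mix (hf : IsDensity μ f) {p : A → ℝ} (hp : p ∈ stdSimplex ℝ A) {a : A}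
    (ha : 0 < p a) :
    (μ.withDensity fun y => ENNReal.ofReal (mix p f y)).withDensity
      (fun y => ENNReal.ofReal (f a y / mix p f y)) =
      μ.withDensity fun y => ENNReal.ofReal (f a y) := by
  have hm := hf.mix_one hp
  have hd : Measurable fun y => ENNReal.ofReal (f a y / mix p f y) :=
    ((hf.meas a).div (hm.meas ())).ennreal_ofReal
  rw [← withDensity_mul _ (hm.meas ()).ennreal_ofReal hd]
  congr 1
  funext y
  rw [Pi.mul_apply, ← ENNReal.ofReal_mul (hm.nonneg () y)]
  congr 1
  -- Where the mixture vanishes, so does f a because p a > 0; the value of the quotient there is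
  -- harmless.
  rcases eq_or_ne (mix p f y) 0 with h | h
  · have h1 := mul_le_mix hf hp.1 a y
    rw [h] at h1
    have : f a y = 0 := le_antisymm (nonpos_of_mul_nonpos_right h1 ha) (hf.nonneg a y)
    simp [this]
  · rw [mul_div_cancel₀ _ h]

lemma rnDeriv_mix (hf : IsDensity μ f)
    (hV : ∀ a, V a = μ.withDensity fun y => ENNReal.ofReal (f a y)) {p : A → ℝ}
    (hp : p ∈ stdSimplex ℝ A) {a : A} (ha : 0 < p a) :
    V a ≪ outputMeasure V p ∧
    (fun y => ((V a).rnDeriv (outputMeasure V p) y).toReal) =ᵐ[outputMeasure V p]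
      fun y => f a y / mix p f y := by
  have hm := hf.mix_one hp
  rw [outputMeasure_eq hf hV hp.1, hV a, ← withDensity_div_mix hf hp ha]
  have := isProbabilityMeasure_withDensity hm ()
  have hd : Measurable fun y => ENNReal.ofReal (f a y / mix p f y) :=
    ((hf.meas a).div (hm.meas ())).ennreal_ofReal
  refine ⟨withDensity_absolutelyContinuous _ _, ?_⟩
  filter_upwards [Measure.rnDeriv_withDensity (μ.withDensity fun y => ENNReal.ofReal (mix p f y))
    hd] with y hy
  rw [hy, ENNReal.toReal_ofReal (div_nonneg (hf.nonneg a y) (hm.nonneg () y))]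

lemma integrable_mul_log_mix (hf : IsDensity μ f) {p : A → ℝ} (hp : p ∈ stdSimplex ℝ A) (a : A) :
    Integrable (fun y => p a * f a y * Real.log (mix p f y)) μ := by
  have hm := hf.mix_one hp
  exact integrable_of_abs_le (((hf.meas a).const_mul _).mul
    (Real.measurable_log.comp (hm.meas ()))) 1 fun y =>
    abs_mul_log_le (mul_nonneg (hp.1 a) (hf.nonneg a y)) (mul_le_mix hf hp.1 a y) (hm.le_one () y)

lemma integrable_mul_log_div (hf : IsDensity μ f) {p : A → ℝ} (hp : p ∈ stdSimplex ℝ A) {a : A}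
    (ha : 0 < p a) : Integrable (fun y => f a y * Real.log (f a y / mix p f y)) μ ∧
      p a * ∫ y, f a y * Real.log (f a y / mix p f y) ∂μ =
        -(p a * densEntropy μ (f a)) - ∫ y, p a * f a y * Real.log (mix p f y) ∂μ := by
  have hm := hf.mix_one hp
  -- The factor p a is inserted and removed because p a * f a, unlike f a, is bounded by the
  -- mixture, which makes the second term integrable.
  have e : ∀ y, f a y * Real.log (f a y / mix p f y) =
      -negMulLog (f a y) - (p a)⁻¹ * (p a * f a y * Real.log (mix p f y)) := by
    intro y
    rcases (hf.nonneg a y).eq_or_lt with h | h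
    · simp [← h]
    · have := (mul_pos ha h).trans_le (mul_le_mix hf hp.1 a y)
      rw [Real.log_div h.ne' this.ne', negMulLog]
      field_simp
  have i1 := (hf.integrable_negMulLog a).neg
  have i2 := (integrable_mul_log_mix hf hp a).const_mul (p a)⁻¹
  simp only [e]
  refine ⟨i1.sub i2, ?_⟩
  have e2 : ∫ y, (-negMulLog (f a y) - (p a)⁻¹ * (p a * f a y * Real.log (mix p f y))) ∂μ =
      -densEntropy μ (f a) - (p a)⁻¹ * ∫ y, p a * f a y * Real.log (mix p f y) ∂μ := by
    refine (integral_sub i1 i2).trans ?_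
    rw [integral_const_mul]
    congr 1
    exact integral_neg _
  rw [e2, mul_sub, mul_inv_cancel_left₀ ha.ne']
  ring

lemma sum_integral_mul_log_mix (hf : IsDensity μ f) {p : A → ℝ} (hp : p ∈ stdSimplex ℝ A) :
    ∑ a, (-(p a * densEntropy μ (f a)) - ∫ y, p a * f a y * Real.log (mix p f y) ∂μ) =
      densInfo μ f p := by
  rw [Finset.sum_sub_distrib, ← integral_finsetSum _ fun a _ => integrable_mul_log_mix hf hp a,
    Finset.sum_neg_distrib, densInfo, densEntropy]
  simp only [← Finset.sum_mul]
  have : ∫ y, (∑ a, p a * f a y) * Real.log (mix p f y) ∂μ = - ∫ y, negMulLog (mix p f y) ∂μ := by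
    rw [← integral_neg]
    simp only [negMulLog, neg_mul, neg_neg]
    rfl
  rw [this]; ring

lemma toReal_klDiv_mix (hf : IsDensity μ f)
    (hV : ∀ a, V a = μ.withDensity fun y => ENNReal.ofReal (f a y)) {p : A → ℝ}
    (hp : p ∈ stdSimplex ℝ A) {a : A} (ha : 0 < p a) :
    klDiv (V a) (outputMeasure V p) ≠ ⊤ ∧ (klDiv (V a) (outputMeasure V p)).toReal =
      ∫ y, f a y * Real.log (f a y / mix p f y) ∂μ := by
  have hm := hf.mix_one hp
  obtain ⟨hac, hrn⟩ := rnDeriv_mix hf hV hp ha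
  have h1 : IsProbabilityMeasure (V a) := by
    rw [hV a]; exact isProbabilityMeasure_withDensity hf a
  have h2 : IsProbabilityMeasure (outputMeasure V p) := by
    rw [outputMeasure_eq hf hV hp.1]; exact isProbabilityMeasure_withDensity hm ()
  have hllr : llr (V a) (outputMeasure V p) =ᵐ[V a] fun y => Real.log (f a y / mix p f y) := by
    filter_upwards [hac.ae_le hrn] with y hy
    rw [llr, hy]
  constructor
  · refine klDiv_ne_top hac ?_
    rw [integrable_congr hllr, hV a]
    exact integrable_withDensity_ofReal (hf.meas a) (hf.nonneg a)
      (integrable_mul_log_div hf hp ha).1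
  · rw [toReal_klDiv_of_measure_eq hac (by simp), integral_congr_ae hllr, hV a,
      integral_withDensity_ofReal (hf.meas a) (hf.nonneg a)]

lemma sum_mul_toReal_klDiv (hf : IsDensity μ f)
    (hV : ∀ a, V a = μ.withDensity fun y => ENNReal.ofReal (f a y)) {p : A → ℝ}
    (hp : p ∈ stdSimplex ℝ A) :
    ∑ a, p a * (klDiv (V a) (outputMeasure V p)).toReal = densInfo μ f p := by
  rw [← sum_integral_mul_log_mix hf hp]
  refine Finset.sum_congr rfl fun a _ => ?_
  rcases (hp.1 a).eq_or_lt with h | h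
  · simp [← h]
  · rw [← (integrable_mul_log_div hf hp h).2, (toReal_klDiv_mix hf hV hp h).2]

lemma mutualInfo_eq (hf : IsDensity μ f)
    (hV : ∀ a, V a = μ.withDensity fun y => ENNReal.ofReal (f a y)) {p : A → ℝ}
    (hp : p ∈ stdSimplex ℝ A) : mutualInfo V p = densInfo μ f p / Real.log 2 := by
  rw [← sum_mul_toReal_klDiv hf hV hp, mutualInfo, Finset.sum_div]
  refine Finset.sum_congr rfl fun a _ => ?_
  rw [divergence, ENNReal.toReal_div, ENNReal.toReal_ofReal (Real.log_nonneg one_le_two), mul_div]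

lemma entropy_eq {A : Type*} [Fintype A] (q : A → ℝ) : entropy q = natEntropy q / Real.log 2 := by
  rw [entropy, natEntropy, Finset.sum_div, ← Finset.sum_neg_distrib]
  refine Finset.sum_congr rfl fun a _ => ?_
  rw [negMulLog, Real.logb]; ring

lemma equivocation_eq (hf : IsDensity μ f)
    (hV : ∀ a, V a = μ.withDensity fun y => ENNReal.ofReal (f a y)) {p : A → ℝ}
    (hp : p ∈ stdSimplex ℝ A) :
    equivocation V p = (natEntropy p - densInfo μ f p) / Real.log 2 := by
  have hm := hf.mix_one hp
  have hpost : ∀ᵐ y ∂(outputMeasure V p), ∀ a, posterior V p y a = p a * f a y / mix p f y := by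
    rw [ae_all_iff]
    intro a
    rcases (hp.1 a).eq_or_lt with h | h
    · simp [posterior, ← h]
    · filter_upwards [(rnDeriv_mix hf hV hp h).2] with y hy
      rw [posterior, hy, mul_div]
  have h1 : equivocation V p =
      ∫ y, natEntropy (fun a => p a * f a y / mix p f y) / Real.log 2 ∂(outputMeasure V p) := by
    refine integral_congr_ae ?_
    filter_upwards [hpost] with y hy
    rw [entropy_eq]
    congr 2
    funext a
    exact hy a
  rw [h1, integral_div, outputMeasure_eq hf hV hp.1,
    integral_withDensity_ofReal (hm.meas ()) (hm.nonneg ()), natEntropy_sub_densInfo hf hp]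
  congr 2
  funext y
  rcases (hm.nonneg () y).eq_or_lt with h | h
  · have h0 : ∀ a, p a * f a y = 0 := fun a =>
      le_antisymm ((mul_le_mix hf hp.1 a y).trans_eq h.symm)
        (mul_nonneg (hp.1 a) (hf.nonneg a y))
    simp [← h, h0]
  · set t := mix p f y with ht
    -- Weighting the posterior entropy by the output density t turns it into the entropy of the
    -- unnormalized joint values minus `negMulLog t`.
    have e : ∀ a, t * negMulLog (p a * f a y / t) =
        negMulLog (p a * f a y) - (p a * f a y) * (negMulLog t / t) := by
      intro a
      have := Real.negMulLog_mul t (p a * f a y / t)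
      rw [mul_div_cancel₀ _ h.ne'] at this
      rw [this]; ring
    have e2 : ∑ a, p a * f a y = t := rfl
    rw [natEntropy, Finset.mul_sum]
    simp only [e]
    rw [Finset.sum_sub_distrib, ← Finset.sum_mul, e2, mul_div_cancel₀ _ h.ne']

/-! ### Realizing points of the information set -/

/-- The weights of a convex combination become the law of U and its points the conditional laws of
X. -/
lemma exists_joint (hf : IsDensity μ f)
    (hV : ∀ a, V a = μ.withDensity fun y => ENNReal.ofReal (f a y)) {v : ℝ × ℝ}
    (hv : v ∈ infoSet μ f) :
    ∃ (k : ℕ) (P : Fin k × A → ℝ), P ∈ stdSimplex ℝ (Fin k × A) ∧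
      condMutualInfo V P = v.1 / Real.log 2 ∧ condEntropy P = v.2 / Real.log 2 ∧
      condEquivocation V P = (v.2 - v.1) / Real.log 2 := by
  obtain ⟨ι, _, w, z, hw0, hw1, hz, rfl⟩ := mem_convexHull_iff_exists_fintype.1 hv
  choose p hp hpz using hz
  set e := (Fintype.equivFin ι).symm
  set P : Fin (Fintype.card ι) × A → ℝ := fun a => w (e a.1) * p (e a.1) a.2 with hP
  have hmarg : ∀ u, marginalU P u = w (e u) := fun u => by
    simp only [marginalU, hP, ← Finset.mul_sum, (hp _).2, mul_one]
  have hcond : ∀ u, w (e u) ≠ 0 → condX P u = p (e u) := fun u hu => by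
    funext x
    rw [condX, hmarg, hP, mul_div_cancel_left₀ _ hu]
  -- Values of U of weight zero drop out, whatever `condX` is there.
  have hgen : ∀ (F : (A → ℝ) → ℝ) (G : ι → ℝ), (∀ i, F (p i) = G i) →
      ∑ u, marginalU P u * F (condX P u) = ∑ i, w i * G i := by
    intro F G hFG
    rw [← e.sum_comp]
    refine Finset.sum_congr rfl fun u _ => ?_
    rw [hmarg]
    rcases eq_or_ne (w (e u)) 0 with h | h
    · simp [h]
    · rw [hcond u h, hFG]
  have hz1 : ∀ i, densInfo μ f (p i) = (z i).1 := fun i => by rw [← hpz]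
  have hz2 : ∀ i, natEntropy (p i) = (z i).2 := fun i => by rw [← hpz]
  simp only [Prod.fst_sum, Prod.snd_sum, Prod.smul_fst, Prod.smul_snd, smul_eq_mul]
  refine ⟨_, P, ⟨fun a => mul_nonneg (hw0 _) ((hp _).1 _), ?_⟩, ?_, ?_, ?_⟩
  · rw [Fintype.sum_prod_type]
    exact (Finset.sum_congr rfl fun u _ => hmarg u).trans ((e.sum_comp w).trans hw1)
  · rw [condMutualInfo, hgen (mutualInfo V) (fun i => (z i).1 / Real.log 2) fun i => by
      rw [mutualInfo_eq hf hV (hp i), hz1], Finset.sum_div]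
    exact Finset.sum_congr rfl fun i _ => (mul_div_assoc _ _ _).symm
  · have : condEntropy P = ∑ u, marginalU P u * entropy (condX P u) := by
      rw [condEntropy, ← Finset.sum_neg_distrib]
      refine Finset.sum_congr rfl fun u _ => ?_
      rw [entropy, mul_neg, Finset.mul_sum]
      congr 1
      refine Finset.sum_congr rfl fun x _ => ?_
      rw [condX, ← mul_assoc]
      congr 1
      rcases eq_or_ne (w (e u)) 0 with h | h
      · simp [hP, h]
      · rw [hmarg, mul_div_cancel₀ _ h]
    rw [this, hgen entropy (fun i => (z i).2 / Real.log 2) fun i => by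
      rw [entropy_eq, hz2], Finset.sum_div]
    exact Finset.sum_congr rfl fun i _ => (mul_div_assoc _ _ _).symm
  · rw [condEquivocation, hgen (equivocation V) (fun i => ((z i).2 - (z i).1) / Real.log 2)
      fun i => by rw [equivocation_eq hf hV (hp i), hz1, hz2], ← Finset.sum_sub_distrib,
      Finset.sum_div]
    exact Finset.sum_congr rfl fun i _ => by ring

end

/-- Limits of approximately admissible triples are limits of strictly admissible ones. -/
lemma mem_closure_of_approx {G : Set (ℝ × ℝ × ℝ)} {S : Set (ℝ × ℝ)} (hS : Convex ℝ S) {κ : ℝ}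
    (hκ0 : 0 ≤ κ)
    (hG : ∀ v ∈ S, ∀ R₁ R₂ R₃ : ℝ, 0 < R₁ - R₂ → R₁ - R₂ < v.1 →
      R₃ ≤ (1 - κ) * R₁ + κ * v.2 - v.1 → R₁ < v.2 → 0 < R₁ → 0 < R₂ → 0 < R₃ →
      (R₁, R₂, R₃) ∈ G)
    {v₀ : ℝ × ℝ} (hv₀ : v₀ ∈ S) (h₀ : 0 < v₀.1) (h₁ : v₀.1 < v₀.2) {R₁ R₂ R₃ : ℝ}
    (hR₂ : 0 ≤ R₂) (hR₃ : 0 ≤ R₃) (hR : R₂ ≤ R₁)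
    (happ : ∀ ε > 0, ∃ v ∈ S, R₁ - R₂ ≤ v.1 + ε ∧
      R₃ ≤ (1 - κ) * R₁ + κ * v.2 - v.1 + ε ∧ R₁ ≤ v.2 + ε) :
    (R₁, R₂, R₃) ∈ closure G := by
  -- A triple satisfying every constraint at v₀ with room to spare: r₁ − r₂ = v₀.1 / 2, r₁ is midway
  -- between v₀.1 and v₀.2, and r₃ is half of its bound. The number c is a common lower bound for
  -- the slacks.
  set r₁ : ℝ := (v₀.1 + v₀.2) / 2 with hr₁
  set r₂ : ℝ := v₀.2 / 2 with hr₂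
  set r₃ : ℝ := ((1 - κ) * r₁ + κ * v₀.2 - v₀.1) / 2 with hr₃
  have hr₃pos : 0 < r₃ := by
    have : (1 - κ) * r₁ + κ * v₀.2 - v₀.1 = (1 + κ) * ((v₀.2 - v₀.1) / 2) := by rw [hr₁]; ring
    rw [hr₃, this]
    have : 0 < (v₀.2 - v₀.1) / 2 := by linarith
    positivity
  set c : ℝ := min (min (v₀.1 / 2) ((v₀.2 - v₀.1) / 2)) r₃ with hc
  have hcpos : 0 < c := by
    refine lt_min (lt_min ?_ ?_) hr₃pos <;> linarith
  have hc1 : c ≤ v₀.1 / 2 := (min_le_left _ _).trans (min_le_left _ _)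
  have hc2 : c ≤ (v₀.2 - v₀.1) / 2 := (min_le_left _ _).trans (min_le_right _ _)
  have hc3 : c ≤ r₃ := min_le_right _ _
  have hlim : Tendsto (fun t : ℝ => ((1 - t) * R₁ + t * r₁, (1 - t) * R₂ + t * r₂,
      (1 - t) * R₃ + t * r₃)) (𝓝[>] 0) (𝓝 (R₁, R₂, R₃)) := by
    have : Continuous (fun t : ℝ => ((1 - t) * R₁ + t * r₁, (1 - t) * R₂ + t * r₂,
      (1 - t) * R₃ + t * r₃)) := by fun_prop
    have := this.tendsto 0
    simp only [sub_zero, one_mul, zero_mul, add_zero] at this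
    exact this.mono_left nhdsWithin_le_nhds
  refine mem_closure_of_tendsto hlim ?_
  filter_upwards [Ioo_mem_nhdsGT (zero_lt_one' ℝ)] with t ht
  obtain ⟨ht0, ht1⟩ := ht
  have ht1' : 0 ≤ 1 - t := by linarith
  -- A weight t on v₀ gains slack at least t * c, twice the error admitted here.
  obtain ⟨v, hv, a1, a2, a3⟩ := happ (t * c / 2) (by positivity)
  have htc : 0 < t * c := mul_pos ht0 hcpos
  have hε : (1 - t) * (t * c / 2) ≤ t * c / 2 := mul_le_of_le_one_left (by positivity) (by linarith)
  have b1 := mul_le_mul_of_nonneg_left a1 ht1'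
  have b2 := mul_le_mul_of_nonneg_left a2 ht1'
  have b3 := mul_le_mul_of_nonneg_left a3 ht1'
  have d1 := mul_le_mul_of_nonneg_left hc1 ht0.le
  have d2 := mul_le_mul_of_nonneg_left hc2 ht0.le
  have d3 := mul_le_mul_of_nonneg_left hc3 ht0.le
  have q1 := mul_nonneg ht1' (sub_nonneg.2 hR)
  have q2 := mul_nonneg ht1' hR₂
  have q3 := mul_nonneg ht1' hR₃
  have s1 : 0 < t * v₀.1 := mul_pos ht0 h₀
  have s2 : 0 < t * v₀.2 := mul_pos ht0 (h₀.trans h₁)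
  have s3 : 0 < t * r₃ := mul_pos ht0 hr₃pos
  refine hG ((1 - t) • v + t • v₀) (hS hv hv₀ ht1' ht0.le (by ring)) _ _ _ ?_ ?_ ?_ ?_ ?_ ?_ ?_
  · rw [hr₁, hr₂]; linarith
  · simp only [Prod.fst_add, Prod.smul_fst, smul_eq_mul]
    rw [hr₁, hr₂]; linarith
  · simp only [Prod.fst_add, Prod.smul_fst, Prod.snd_add, Prod.smul_snd, smul_eq_mul]
    have : t * (2 * r₃) = t * ((1 - κ) * r₁ + κ * v₀.2 - v₀.1) := by rw [hr₃]; ring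
    linarith
  · simp only [Prod.snd_add, Prod.smul_snd, smul_eq_mul]
    rw [hr₁]; linarith
  · rw [hr₁]; linarith
  · rw [hr₂]; linarith
  · linarith

/-! ### Bounds for a single code -/

section
variable {A B : Type*} [Fintype A] [MeasurableSpace B] {μ : Measure B} [IsFiniteMeasure μ]
  {f : A → B → ℝ} {V : A → Measure B}

/-- The mixture minimizes the average divergence. The variational bound with test function f a / mix
is averaged over a: the logarithmic terms give the information, and the tests average to mix / mix,
which is at most 1 even where Q charges the zeros of the mixture. Positivity of p keeps the tests
bounded. -/
lemma densInfo_le_sum_klDiv (hf : IsDensity μ f)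
    (hV : ∀ a, V a = μ.withDensity fun y => ENNReal.ofReal (f a y)) {p : A → ℝ}
    (hp : p ∈ stdSimplex ℝ A) (hpos : ∀ a, 0 < p a) (Q : Measure B) [IsProbabilityMeasure Q]
    (hfin : ∀ a, klDiv (V a) Q ≠ ⊤) :
    densInfo μ f p ≤ ∑ a, p a * (klDiv (V a) Q).toReal := by
  have hm := hf.mix_one hp
  have hr : ∀ a, Measurable fun y => f a y / mix p f y := fun a => (hf.meas a).div (hm.meas ())
  have hr0 : ∀ a y, 0 ≤ f a y / mix p f y := fun a y =>
    div_nonneg (hf.nonneg a y) (hm.nonneg () y)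
  have hrK : ∀ a y, f a y / mix p f y ≤ (p a)⁻¹ := by
    intro a y
    rcases (hm.nonneg () y).eq_or_lt with h | h
    · rw [← h, div_zero]; exact (inv_pos.2 (hpos a)).le
    · rw [div_le_iff₀ h, inv_mul_eq_div, le_div_iff₀ (hpos a), mul_comm]
      exact mul_le_mix hf hp.1 a y
  have hint : ∀ a, Integrable (fun y => f a y / mix p f y) Q := fun a =>
    integrable_of_abs_le (hr a) (p a)⁻¹ fun y => by rw [abs_of_nonneg (hr0 a y)]; exact hrK a y
  have key : ∀ a, ∫ y, f a y * Real.log (f a y / mix p f y) ∂μ - ∫ y, f a y / mix p f y ∂Q + 1 ≤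
      (klDiv (V a) Q).toReal := by
    intro a
    have hprob : IsProbabilityMeasure (V a) := by
      rw [hV a]; exact isProbabilityMeasure_withDensity hf a
    have h1 : ∀ᵐ y ∂(V a), f a y / mix p f y ≠ 0 := by
      rw [hV a, ae_withDensity_iff (hf.meas a).ennreal_ofReal]
      refine ae_of_all _ fun y hy => ?_
      have h0 : 0 < f a y := by simpa using hy
      exact (div_pos h0 ((mul_pos (hpos a) h0).trans_le (mul_le_mix hf hp.1 a y))).ne'
    have h2 : Integrable (fun y => Real.log (f a y / mix p f y)) (V a) := by
      rw [hV a]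
      exact integrable_withDensity_ofReal (hf.meas a) (hf.nonneg a)
        (integrable_mul_log_div hf hp (hpos a)).1
    have h3 := ofReal_le_klDiv (Q := Q) (hr a) (hr0 a) _ (hrK a) h1 h2
    have h4 : ∫ y, Real.log (f a y / mix p f y) ∂(V a) =
        ∫ y, f a y * Real.log (f a y / mix p f y) ∂μ := by
      rw [hV a, integral_withDensity_ofReal (hf.meas a) (hf.nonneg a)]
    rw [h4] at h3
    exact (ENNReal.ofReal_le_iff_le_toReal (hfin a)).1 h3
  have hQ : ∑ a, p a * ∫ y, f a y / mix p f y ∂Q ≤ 1 := by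
    simp only [← integral_const_mul]
    rw [← integral_finsetSum _ fun a _ => (hint a).const_mul _]
    calc ∫ y, ∑ a, p a * (f a y / mix p f y) ∂Q ≤ ∫ _, (1 : ℝ) ∂Q := by
          refine integral_mono (integrable_finsetSum _ fun a _ => (hint a).const_mul _)
            (integrable_const _) fun y => ?_
          simp only [← mul_div_assoc, ← Finset.sum_div]
          exact div_self_le_one (mix p f y)
      _ = 1 := by simp
  have hJ : ∑ a, p a * ∫ y, f a y * Real.log (f a y / mix p f y) ∂μ = densInfo μ f p := by
    rw [← sum_integral_mul_log_mix hf hp]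
    exact Finset.sum_congr rfl fun a _ => (integrable_mul_log_div hf hp (hpos a)).2
  calc densInfo μ f p ≤ ∑ a, p a * (∫ y, f a y * Real.log (f a y / mix p f y) ∂μ -
        ∫ y, f a y / mix p f y ∂Q + 1) := by
        simp only [mul_add, mul_sub, Finset.sum_add_distrib, Finset.sum_sub_distrib, hJ, mul_one,
          hp.2]
        linarith
    _ ≤ _ := Finset.sum_le_sum fun a _ => mul_le_mul_of_nonneg_left (key a) (hp.1 a)

end

/-- Bound on `H(M|X)` for a uniform message `M`, when `X` determines `M` up to a small error. -/
lemma log_add_natEntropy_le {A : Type*} [Fintype A] {M : ℕ} (hM : 0 < M) {φ : Fin M → A → ℝ}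
    (hφ : ∀ m, φ m ∈ stdSimplex ℝ A) (good : Fin M → A → Prop)
    [∀ m a, Decidable (good m a)]
    (huniq : ∀ a m m', good m a → good m' a → m = m') {e : ℝ}
    (he : ∀ m, ∑ a, φ m a * (if good m a then 0 else 1) ≤ e) :
    Real.log M + ∑ m, (M : ℝ)⁻¹ * natEntropy (φ m) - natEntropy (mix (fun _ => (M : ℝ)⁻¹) φ) ≤
      Real.log 2 + e * Real.log M := by
  have hM' : (0 : ℝ) < M := Nat.cast_pos.2 hM
  have hM1 : (1 : ℝ) ≤ M := Nat.one_le_cast.2 hM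
  -- A test law for the message given the input: mass 1/2 on the good message, if there is one, and
  -- 1/2 spread uniformly. Then −log q is at most log 2 for a good message and log 2 + log M
  -- otherwise.
  set q : Fin M → A → ℝ := fun m a => (if good m a then 1 / 2 else 0) + (2 * M : ℝ)⁻¹ with hq
  set p := mix (fun _ => (M : ℝ)⁻¹) φ with hp
  have hqpos : ∀ m a, 0 < q m a := fun m a => by
    simp only [hq]; split_ifs <;> positivity
  have hp0 : ∀ a, 0 ≤ p a := fun a =>
    Finset.sum_nonneg fun m _ => mul_nonneg (inv_nonneg.2 hM'.le) ((hφ m).1 a)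
  have hqsum : ∀ a, ∑ m, q m a ≤ 1 := by
    intro a
    simp only [hq, Finset.sum_add_distrib, Finset.sum_const, Finset.card_univ, Fintype.card_fin,
      nsmul_eq_mul]
    have h1 : (M : ℝ) * (2 * M : ℝ)⁻¹ = 1 / 2 := by field_simp
    have h2 : ∑ m, (if good m a then (1 / 2 : ℝ) else 0) ≤ 1 / 2 := by
      by_cases h : ∃ m, good m a
      · obtain ⟨m, hm⟩ := h
        rw [Finset.sum_eq_single m]
        · simp [hm]
        · intro m' _ hne
          rw [if_neg fun h => hne (huniq a _ _ h hm)]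
        · simp
      · rw [Finset.sum_eq_zero fun m _ => if_neg fun hm => h ⟨m, hm⟩]
        norm_num
    linarith
  have hlogq : ∀ m a, -Real.log (q m a) ≤
      Real.log 2 + (if good m a then 0 else 1) * Real.log M := by
    intro m a
    simp only [hq]
    split_ifs
    · rw [zero_mul, add_zero, neg_le, ← Real.log_inv]
      apply Real.log_le_log (by norm_num)
      have : (0 : ℝ) ≤ (2 * M : ℝ)⁻¹ := by positivity
      linarith
    · rw [zero_add, Real.log_inv, neg_neg, one_mul, Real.log_mul two_ne_zero hM'.ne']
  have hp1 : ∑ a, p a = 1 := by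
    simp only [hp, mix]
    rw [Finset.sum_comm]
    simp only [← Finset.mul_sum, (hφ _).2]
    simp [hM'.ne']
  -- Gibbs' inequality for the joint law of message and input against p a * q m a.
  have key : ∀ m a, negMulLog ((M : ℝ)⁻¹ * φ m a) ≤ -((M : ℝ)⁻¹ * φ m a * Real.log (p a)) +
      (M : ℝ)⁻¹ * φ m a * (Real.log 2 + (if good m a then 0 else 1) * Real.log M) +
      p a * q m a - (M : ℝ)⁻¹ * φ m a := by
    intro m a
    rcases ((hφ m).1 a).eq_or_lt with h0 | h0
    · simp [← h0, mul_nonneg (hp0 a) (hqpos m a).le]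
    · have hx : 0 < (M : ℝ)⁻¹ * φ m a := by positivity
      have hpa : 0 < p a := hx.trans_le (Finset.single_le_sum
        (f := fun m => (M : ℝ)⁻¹ * φ m a)
        (fun m _ => mul_nonneg (inv_nonneg.2 hM'.le) ((hφ m).1 a)) (Finset.mem_univ m))
      have hpq := mul_pos hpa (hqpos m a)
      have := negMulLog_le_cross hx.le hpq.le fun h => absurd h hpq.ne'
      rw [Real.log_mul hpa.ne' (hqpos m a).ne'] at this
      have h2 := mul_le_mul_of_nonneg_left (hlogq m a) hx.le
      linarith
  have hL : ∑ m, ∑ a, negMulLog ((M : ℝ)⁻¹ * φ m a) =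
      Real.log M + ∑ m, (M : ℝ)⁻¹ * natEntropy (φ m) := by
    simp only [Real.negMulLog_mul, Finset.sum_add_distrib, ← Finset.sum_mul, (hφ _).2, one_mul,
      ← Finset.mul_sum, natEntropy]
    simp only [Finset.sum_const, Finset.card_univ, Fintype.card_fin, nsmul_eq_mul, negMulLog,
      Real.log_inv]
    field_simp
  have hR : ∑ m, ∑ a, (-((M : ℝ)⁻¹ * φ m a * Real.log (p a)) +
      (M : ℝ)⁻¹ * φ m a * (Real.log 2 + (if good m a then 0 else 1) * Real.log M) +
      p a * q m a - (M : ℝ)⁻¹ * φ m a) ≤ natEntropy p + (Real.log 2 + e * Real.log M) := by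
    simp only [Finset.sum_add_distrib, Finset.sum_sub_distrib, Finset.sum_neg_distrib]
    have e1 : ∑ m, ∑ a, (M : ℝ)⁻¹ * φ m a * Real.log (p a) = -natEntropy p := by
      rw [Finset.sum_comm]
      simp only [← Finset.sum_mul, natEntropy, negMulLog, neg_mul, Finset.sum_neg_distrib, neg_neg]
      rfl
    have e2 : ∑ m, ∑ a, (M : ℝ)⁻¹ * φ m a *
        (Real.log 2 + (if good m a then 0 else 1) * Real.log M) ≤ Real.log 2 + e * Real.log M := by
      have : ∀ m, ∑ a, (M : ℝ)⁻¹ * φ m a *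
          (Real.log 2 + (if good m a then 0 else 1) * Real.log M) ≤
          (M : ℝ)⁻¹ * (Real.log 2 + e * Real.log M) := by
        intro m
        have h1 : ∑ a, (M : ℝ)⁻¹ * φ m a *
            (Real.log 2 + (if good m a then 0 else 1) * Real.log M) =
            (M : ℝ)⁻¹ * (Real.log 2 * ∑ a, φ m a +
              (∑ a, φ m a * (if good m a then 0 else 1)) * Real.log M) := by
          rw [Finset.mul_sum, Finset.sum_mul, ← Finset.sum_add_distrib, Finset.mul_sum]
          exact Finset.sum_congr rfl fun a _ => by ring
        rw [h1, (hφ m).2, mul_one]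
        have := Real.log_nonneg hM1
        have := he m
        gcongr
      refine (Finset.sum_le_sum fun m _ => this m).trans_eq ?_
      simp [hM'.ne']
    have e3 : ∑ m, ∑ a, p a * q m a ≤ 1 := by
      rw [Finset.sum_comm, ← hp1]
      simp only [← Finset.mul_sum]
      exact Finset.sum_le_sum fun a _ => mul_le_of_le_one_right (hp0 a) (hqsum a)
    have e4 : ∑ m, ∑ a, (M : ℝ)⁻¹ * φ m a = 1 := by
      rw [Finset.sum_comm]; exact hp1
    rw [e1, e4]
    linarith
  have := (Finset.sum_le_sum fun m (_ : m ∈ Finset.univ) =>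
    Finset.sum_le_sum fun a (_ : a ∈ Finset.univ) => key m a).trans hR
  rw [hL] at this
  linarith

/-! ### Equivocation, Fano's inequality and recovery of the message from the input, for one code -/

namespace Code

section
variable {A B : Type*} [Fintype A] [MeasurableSpace B] {μ : Measure B} [IsFiniteMeasure μ]
  {f : A → B → ℝ} {V : A → Measure B} (c : Code A B)

omit [Fintype A] in
lemma M_pos : 0 < c.M := c.L_pos.trans c.L_lt_M

/-- The encoder as a family of probability vectors. -/
def encR (m : Fin c.M) (a : A) : ℝ := (c.enc m a).toReal

/-- The law of the channel input for a uniform message. -/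
def inputLaw : A → ℝ := mix (fun _ => (c.M : ℝ)⁻¹) c.encR

lemma encR_mem (m : Fin c.M) : c.encR m ∈ stdSimplex ℝ A := by
  refine ⟨fun a => ENNReal.toReal_nonneg, ?_⟩
  have h := (c.enc m).tsum_coe
  rw [tsum_fintype] at h
  simp only [encR]
  rw [← ENNReal.toReal_sum fun a _ => (c.enc m).apply_ne_top a, h, ENNReal.toReal_one]

omit [Fintype A] in
lemma unif_mem : (fun _ : Fin c.M => (c.M : ℝ)⁻¹) ∈ stdSimplex ℝ (Fin c.M) := by
  have : (c.M : ℝ) ≠ 0 := Nat.cast_ne_zero.2 c.M_pos.ne'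
  exact ⟨fun _ => by positivity, by simp [this]⟩

lemma inputLaw_mem : c.inputLaw ∈ stdSimplex ℝ A := by
  refine ⟨fun a => ?_, ?_⟩
  · change 0 ≤ ∑ m, (c.M : ℝ)⁻¹ * c.encR m a
    exact Finset.sum_nonneg fun m _ => mul_nonneg (c.unif_mem.1 m) ((c.encR_mem m).1 a)
  simp only [inputLaw, mix]
  rw [Finset.sum_comm]
  simp only [← Finset.mul_sum, (c.encR_mem _).2, mul_one]
  exact c.unif_mem.2

lemma outputLaw_eq_outputMeasure (m : Fin c.M) :
    c.outputLaw V m = outputMeasure V (c.encR m) := by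
  simp only [outputLaw, outputMeasure, encR, ENNReal.ofReal_toReal ((c.enc m).apply_ne_top _)]

/-- The output densities of the messages. -/
def msgDens (f : A → B → ℝ) (m : Fin c.M) : B → ℝ := mix (c.encR m) f

omit [IsFiniteMeasure μ] in
lemma outputLaw_eq (hf : IsDensity μ f)
    (hV : ∀ a, V a = μ.withDensity fun y => ENNReal.ofReal (f a y)) (m : Fin c.M) :
    c.outputLaw V m = μ.withDensity fun y => ENNReal.ofReal (c.msgDens f m y) := by
  rw [outputLaw_eq_outputMeasure, outputMeasure_eq hf hV (c.encR_mem m).1]; rfl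

lemma isDensity_msgDens (hf : IsDensity μ f) : IsDensity μ (c.msgDens f) := hf.mix c.encR_mem

-- The chain rule I(M;Y) = I(X;Y) − I(X;Y|M) for the Markov chain from message to input to output.
omit [IsFiniteMeasure μ] in
lemma densInfo_msgDens :
    densInfo μ (c.msgDens f) (fun _ => (c.M : ℝ)⁻¹) =
      densInfo μ f c.inputLaw - ∑ m, (c.M : ℝ)⁻¹ * densInfo μ f (c.encR m) := by
  have h1 : mix (fun _ => (c.M : ℝ)⁻¹) (c.msgDens f) = mix c.inputLaw f := by
    funext y
    simp only [mix, msgDens, inputLaw, Finset.mul_sum, Finset.sum_mul]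
    rw [Finset.sum_comm]
    exact Finset.sum_congr rfl fun a _ => Finset.sum_congr rfl fun m _ => by ring
  have h2 : ∑ a, c.inputLaw a * densEntropy μ (f a) =
      ∑ m, (c.M : ℝ)⁻¹ * ∑ a, c.encR m a * densEntropy μ (f a) := by
    simp only [mix, inputLaw, Finset.mul_sum, Finset.sum_mul]
    rw [Finset.sum_comm]
    exact Finset.sum_congr rfl fun a _ => Finset.sum_congr rfl fun m _ => by ring
  simp only [densInfo, mul_sub, Finset.sum_sub_distrib, ← h2, h1, msgDens]
  ring

lemma equiv_mul_log_le (hf : IsDensity μ f)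
    (hV : ∀ a, V a = μ.withDensity fun y => ENNReal.ofReal (f a y)) :
    c.equiv V * Real.log 2 ≤
      Real.log c.M - densInfo μ (c.msgDens f) (fun _ => (c.M : ℝ)⁻¹) := by
  have hlog : 0 < Real.log 2 := Real.log_pos one_lt_two
  have hM : (0 : ℝ) < c.M := Nat.cast_pos.2 c.M_pos
  have hg := c.isDensity_msgDens hf
  have hVm := fun m => c.outputLaw_eq hf hV m
  set J := densInfo μ (c.msgDens f) (fun _ => (c.M : ℝ)⁻¹) with hJ
  have hpos : ∀ _ : Fin c.M, 0 < (c.M : ℝ)⁻¹ := fun _ => inv_pos.2 hM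
  have hlog0 : ENNReal.ofReal (Real.log 2) ≠ 0 := by simpa using hlog
  have hlow : ∀ Q : ProbabilityMeasure B, ENNReal.ofReal (J / Real.log 2) ≤
      ∑ m, (c.M : ℝ≥0∞)⁻¹ * divergence (c.outputLaw V m) (Q : Measure B) := by
    intro Q
    by_cases htop : ∑ m, (c.M : ℝ≥0∞)⁻¹ * divergence (c.outputLaw V m) (Q : Measure B) = ⊤
    · simp [htop]
    have hfin : ∀ m, klDiv (c.outputLaw V m) (Q : Measure B) ≠ ⊤ := by
      intro m hm
      apply htop
      rw [ENNReal.sum_eq_top]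
      refine ⟨m, Finset.mem_univ m, ?_⟩
      rw [divergence, hm, ENNReal.top_div_of_ne_top ENNReal.ofReal_ne_top, ENNReal.mul_top]
      simp
    rw [ENNReal.ofReal_le_iff_le_toReal htop, ENNReal.toReal_sum fun m _ h => htop
      (ENNReal.sum_eq_top.2 ⟨m, Finset.mem_univ m, h⟩), div_le_iff₀ hlog]
    refine (densInfo_le_sum_klDiv hg hVm c.unif_mem hpos (Q : Measure B) hfin).trans_eq ?_
    rw [Finset.sum_mul]
    refine Finset.sum_congr rfl fun m _ => ?_
    rw [divergence, ENNReal.toReal_mul, ENNReal.toReal_div, ENNReal.toReal_ofReal hlog.le,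
      ENNReal.toReal_inv, ENNReal.toReal_natCast, mul_assoc, div_mul_cancel₀ _ hlog.ne']
  -- Finiteness must be checked, since `toReal` would turn an infinite infimum into 0. The output
  -- law of a uniform message is a Q with finite average divergence.
  have hne : (⨅ Q : ProbabilityMeasure B,
      ∑ m, (c.M : ℝ≥0∞)⁻¹ * divergence (c.outputLaw V m) (Q : Measure B)) ≠ ⊤ := by
    have hprob : IsProbabilityMeasure
        (outputMeasure (c.outputLaw V) fun _ => (c.M : ℝ)⁻¹) := by
      rw [outputMeasure_eq hg hVm c.unif_mem.1]
      exact isProbabilityMeasure_withDensity (hg.mix_one c.unif_mem) ()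
    refine ne_top_of_le_ne_top ?_ (iInf_le _ ⟨_, hprob⟩)
    rw [Ne, ENNReal.sum_eq_top]
    rintro ⟨m, -, hm⟩
    rw [divergence] at hm
    refine ENNReal.mul_ne_top (by simp [c.M_pos.ne']) (ENNReal.div_ne_top ?_ hlog0) hm
    exact (toReal_klDiv_mix hg hVm c.unif_mem (hpos m)).1
  have h := (ENNReal.ofReal_le_iff_le_toReal hne).1 (le_iInf hlow)
  rw [div_le_iff₀ hlog] at h
  rw [equiv, sub_mul, Real.logb, div_mul_cancel₀ _ hlog.ne']
  linarith

/-- The list-decoding version of Fano's inequality. -/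
lemma le_densInfo_msgDens (hf : IsDensity μ f)
    (hV : ∀ a, V a = μ.withDensity fun y => ENNReal.ofReal (f a y)) {ε : ℝ}
    (hε : ∀ m, 1 - ε ≤ c.listProb (c.outputLaw V m) m) :
    (1 - ε) * (Real.log c.M - Real.log c.L) - 1 ≤
      densInfo μ (c.msgDens f) (fun _ => (c.M : ℝ)⁻¹) := by
  have hM : (0 : ℝ) < c.M := Nat.cast_pos.2 c.M_pos
  have hL : (0 : ℝ) < c.L := Nat.cast_pos.2 c.L_pos
  have hML : (1 : ℝ) < c.M / c.L := by rw [one_lt_div hL]; exact Nat.cast_lt.2 c.L_lt_M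
  have hg := c.isDensity_msgDens hf
  have hVm := fun m => c.outputLaw_eq hf hV m
  have hprobm : ∀ m, IsProbabilityMeasure (c.outputLaw V m) := fun m => by
    rw [hVm]; exact isProbabilityMeasure_withDensity hg m
  set Q := outputMeasure (c.outputLaw V) fun _ => (c.M : ℝ)⁻¹ with hQ
  have hprob : IsProbabilityMeasure Q := by
    rw [hQ, outputMeasure_eq hg hVm c.unif_mem.1]
    exact isProbabilityMeasure_withDensity (hg.mix_one c.unif_mem) ()
  set t := Real.log (c.M / c.L) with ht
  have htpos : 0 ≤ t := Real.log_nonneg hML.le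
  set E : Fin c.M → Set B := fun m => {y | m ∈ c.dec y} with hE
  have hEm : ∀ m, MeasurableSet (E m) := c.measurableSet_dec
  have key : ∀ m, t * (c.outputLaw V m).real (E m) - (c.M / c.L - 1) * Q.real (E m) ≤
      (klDiv (c.outputLaw V m) Q).toReal := by
    intro m
    -- The test function equals M / L when m is on the list and 1 otherwise: under the output law Q
    -- a list contains a given message with average probability at most L / M.
    set r : B → ℝ := fun y => 1 + (E m).indicator (fun _ => (c.M / c.L - 1 : ℝ)) y with hr
    have hrm : Measurable r := measurable_const.add (measurable_const.indicator (hEm m))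
    have hi0 : ∀ y, 0 ≤ (E m).indicator (fun _ => (c.M / c.L - 1 : ℝ)) y := fun y =>
      Set.indicator_nonneg (fun _ _ => by linarith) y
    have hi1 : ∀ y, (E m).indicator (fun _ => (c.M / c.L - 1 : ℝ)) y ≤ c.M / c.L - 1 := fun y =>
      Set.indicator_le_self' (fun _ _ => by linarith) y
    have hlogr : (fun y => Real.log (r y)) = (E m).indicator fun _ => t := by
      funext y
      by_cases hy : y ∈ E m
      · simp only [hr, Set.indicator_of_mem hy, add_sub_cancel, ht]
      · simp only [hr, Set.indicator_of_notMem hy, add_zero, Real.log_one]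
    have h := ofReal_le_klDiv (P := c.outputLaw V m) (Q := Q) hrm
      (fun y => by have := hi0 y; simp only [hr]; linarith) (c.M / c.L)
      (fun y => by have := hi1 y; simp only [hr]; linarith)
      (ae_of_all _ fun y => by have := hi0 y; simp only [hr]; positivity)
      (by rw [hlogr]; exact (integrable_const t).indicator (hEm m))
    rw [ENNReal.ofReal_le_iff_le_toReal
      (toReal_klDiv_mix hg hVm c.unif_mem (inv_pos.2 hM)).1] at h
    refine le_trans (le_of_eq ?_) h
    rw [hlogr, integral_indicator_const _ (hEm m), hr,
      integral_add (integrable_const _) ((integrable_const _).indicator (hEm m)),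
      integral_indicator_const _ (hEm m)]
    simp only [integral_const, probReal_univ, smul_eq_mul]
    ring
  -- The indicators of the events E m add up to the size of the list.
  have hQsum : ∑ m, Q.real (E m) ≤ c.L := by
    have h1 : ∀ m, Q.real (E m) = ∫ y, (E m).indicator (fun _ => (1 : ℝ)) y ∂Q := fun m => by
      rw [integral_indicator_const _ (hEm m)]; simp
    simp only [h1]
    rw [← integral_finsetSum _ fun m _ => (integrable_const _).indicator (hEm m)]
    calc _ ≤ ∫ _, (c.L : ℝ) ∂Q := by
          refine integral_mono (integrable_finsetSum _ fun m _ =>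
            (integrable_const _).indicator (hEm m)) (integrable_const _) fun y => ?_
          have h2 : ∑ m, (E m).indicator (fun _ => (1 : ℝ)) y = ((c.dec y).card : ℝ) := by
            simp only [Set.indicator_apply, hE, Set.mem_ofPred_eq]
            simp
          simp only [h2]
          exact_mod_cast c.card_dec_le y
      _ = c.L := by simp
  rw [← sum_mul_toReal_klDiv hg hVm c.unif_mem, ← Real.log_div hM.ne' hL.ne']
  have h1 : ∀ m, t * (1 - ε) - (c.M / c.L - 1) * Q.real (E m) ≤
      (klDiv (c.outputLaw V m) Q).toReal := fun m =>
    le_trans (sub_le_sub_right (mul_le_mul_of_nonneg_left (hε m) htpos) _) (key m)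
  have h2 := Finset.sum_le_sum fun m (_ : m ∈ Finset.univ) =>
    mul_le_mul_of_nonneg_left (h1 m) (inv_nonneg.2 hM.le)
  refine le_trans ?_ h2
  rw [← Finset.mul_sum, Finset.sum_sub_distrib, Finset.sum_const, Finset.card_univ,
    Fintype.card_fin, nsmul_eq_mul, ← Finset.mul_sum]
  have h3 : (c.M / c.L - 1 : ℝ) * ∑ m, Q.real (E m) ≤ c.M := by
    calc _ ≤ (c.M / c.L - 1 : ℝ) * c.L := by gcongr
      _ = c.M - c.L := by field_simp
      _ ≤ c.M := by linarith
  have h4 : (c.M : ℝ)⁻¹ * ((c.M / c.L - 1 : ℝ) * ∑ m, Q.real (E m)) ≤ 1 := by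
    rw [inv_mul_le_iff₀ hM]; linarith
  rw [mul_sub, inv_mul_cancel_left₀ hM.ne', ← ht]
  linarith

lemma one_sub_epsA_le (m : Fin c.M) : 1 - c.epsA V ≤ c.listProb (c.outputLaw V m) m := by
  have := le_ciSup (Set.finite_range fun m => 1 - c.listProb (c.outputLaw V m) m).bddAbove m
  simp only [epsA]
  linarith

lemma listProb_le_deltaC {m m' : Fin c.M} (h : m' ≠ m) :
    c.listProb (c.outputLaw V m) m' ≤ c.deltaC V := by
  refine le_trans ?_ (le_ciSup (Set.finite_range fun m => ⨆ m' : {m' // m' ≠ m},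
    c.listProb (c.outputLaw V m) m').bddAbove m)
  exact le_ciSup (f := fun m' : {m' // m' ≠ m} => c.listProb (c.outputLaw V m) m')
    (Set.finite_range _).bddAbove ⟨m', h⟩

lemma min_listProb_le_deltaD (a : A) {m m' : Fin c.M} (h : m ≠ m') :
    min (c.listProb (V a) m) (c.listProb (V a) m') ≤ c.deltaD V := by
  refine le_trans ?_ (le_ciSup (Set.finite_range fun a => c.deltaDAt V a).bddAbove a)
  exact le_ciSup (f := fun p : {p : Fin c.M × Fin c.M // p.1 ≠ p.2} =>
    min (c.listProb (V a) p.1.1) (c.listProb (V a) p.1.2)) (Set.finite_range _).bddAbove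
    ⟨(m, m'), h⟩

lemma listProb_outputLaw [∀ a, IsProbabilityMeasure (V a)] (m m' : Fin c.M) :
    c.listProb (c.outputLaw V m) m' = ∑ a, c.encR m a * c.listProb (V a) m' := by
  rw [listProb, outputLaw, Measure.real, Measure.finsetSum_apply, ENNReal.toReal_sum]
  · simp [encR, listProb, Measure.real]
  · intro a _
    exact ENNReal.mul_ne_top ((c.enc m).apply_ne_top a) (measure_ne_top _ _)

/-- `m` is decoded from the input `a` with probability more than one half. -/
def LikelyFrom (V : A → Measure B) (m : Fin c.M) (a : A) : Prop := 1 / 2 < c.listProb (V a) m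

/-- Two such messages would push the second largest listing probability at a above 1/2. -/
lemma LikelyFrom.unique {c : Code A B} (hδ : c.deltaD V < 1 / 2) (a : A) (m m' : Fin c.M)
    (h : c.LikelyFrom V m a) (h' : c.LikelyFrom V m' a) : m = m' := by
  by_contra hne
  exact absurd ((lt_min h h').trans_le (c.min_listProb_le_deltaD a hne)) (not_lt.2 hδ.le)

-- Markov's inequality: an input from which m is not likely misses m with probability at least 1/2,
-- while the average miss probability is at most `epsA`. Hence the factor 2.
open Classical in
lemma sum_not_likelyFrom_le [∀ a, IsProbabilityMeasure (V a)] (m : Fin c.M) :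
    ∑ a, c.encR m a * (if c.LikelyFrom V m a then 0 else 1) ≤ 2 * c.epsA V := by
  have h := c.one_sub_epsA_le (V := V) m
  rw [listProb_outputLaw] at h
  have h1 : ∀ a, c.encR m a * (if c.LikelyFrom V m a then 0 else 1) ≤
      2 * (c.encR m a - c.encR m a * c.listProb (V a) m) := by
    intro a
    have h0 : 0 ≤ c.encR m a := ENNReal.toReal_nonneg
    have h2 : c.listProb (V a) m ≤ 1 := measureReal_le_one
    split_ifs with hl
    · nlinarith
    · have := not_lt.1 hl
      nlinarith
  refine (Finset.sum_le_sum fun a _ => h1 a).trans ?_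
  rw [← Finset.mul_sum, Finset.sum_sub_distrib, (c.encR_mem m).2]
  linarith

lemma natEntropy_pure [DecidableEq A] (a : A) : natEntropy (Pi.single a (1 : ℝ)) = 0 := by
  refine Finset.sum_eq_zero fun b _ => ?_
  rcases eq_or_ne b a with rfl | h
  · simp
  · simp [h]

omit [Fintype A] in
variable {c} in
lemma IsDeterministic.exists_encR [DecidableEq A] (h : c.IsDeterministic) :
    ∃ g : Fin c.M → A, ∀ m, c.enc m = PMF.pure (g m) ∧ c.encR m = Pi.single (g m) 1 := by
  obtain ⟨g, hg⟩ := h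
  refine ⟨g, fun m => ⟨hg m, ?_⟩⟩
  funext a
  rw [encR, hg m, PMF.pure_apply, Pi.single_apply]
  split_ifs <;> simp

-- Messages with a common codeword have the same output law, under which m' would be listed with
-- probability both above 1/2, by verifiability, and below 1/2, by binding.
variable {c} in
lemma IsDeterministic.encR_unique (h : c.IsDeterministic) (hε : c.epsA V < 1 / 2)
    (hδ : c.deltaC V < 1 / 2) (a : A) (m m' : Fin c.M) (hm : c.encR m a ≠ 0)
    (hm' : c.encR m' a ≠ 0) : m = m' := by
  classical
  obtain ⟨g, hg⟩ := h.exists_encR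
  have key : ∀ m, c.encR m a ≠ 0 → a = g m := fun m hm => by
    by_contra hne
    rw [(hg m).2, Pi.single_eq_of_ne hne] at hm
    exact hm rfl
  by_contra hne
  have hlaw : c.outputLaw V m = c.outputLaw V m' := by
    simp only [outputLaw, (hg _).1, ← key m hm, ← key m' hm']
  have h1 := c.one_sub_epsA_le (V := V) m'
  rw [← hlaw] at h1
  have h2 := c.listProb_le_deltaC (V := V) (m := m) (m' := m') (Ne.symm hne)
  linarith

/-- The converse bounds for a single code, in nats; `κ = 1` is the general case and `κ = 0` the
deterministic case. -/
lemma exists_inputLaw_bounds (hf : IsDensity μ f)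
    (hV : ∀ a, V a = μ.withDensity fun y => ENNReal.ofReal (f a y))
    (good : Fin c.M → A → Prop) [∀ m a, Decidable (good m a)]
    (huniq : ∀ a m m', good m a → good m' a → m = m') {e : ℝ}
    (he : ∀ m, ∑ a, c.encR m a * (if good m a then 0 else 1) ≤ e) {κ : ℝ}
    (hκ : κ = 1 ∨ κ = 0 ∧ c.IsDeterministic) :
    ∃ p ∈ stdSimplex ℝ A,
      Real.log c.M - (Real.log 2 + e * Real.log c.M) ≤ natEntropy p ∧
      (1 - c.epsA V) * (Real.log c.M - Real.log c.L) - 1 ≤ densInfo μ f p ∧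
      c.equiv V * Real.log 2 ≤ (1 - κ) * Real.log c.M + κ * natEntropy p - densInfo μ f p +
        (Real.log 2 + e * Real.log c.M) := by
  classical
  have hM0 : (0 : ℝ) ≤ (c.M : ℝ)⁻¹ := by positivity
  have hH := log_add_natEntropy_le c.M_pos c.encR_mem good huniq he
  have hE := c.equiv_mul_log_le hf hV
  have hF := c.le_densInfo_msgDens hf hV fun m => c.one_sub_epsA_le m
  rw [densInfo_msgDens] at hE hF
  have hsumH : 0 ≤ ∑ m, (c.M : ℝ)⁻¹ * natEntropy (c.encR m) :=
    Finset.sum_nonneg fun m _ => mul_nonneg hM0 (natEntropy_nonneg (c.encR_mem m))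
  have hsumJ : 0 ≤ ∑ m, (c.M : ℝ)⁻¹ * densInfo μ f (c.encR m) :=
    Finset.sum_nonneg fun m _ => mul_nonneg hM0 (densInfo_nonneg hf (c.encR_mem m))
  have hJH : ∑ m, (c.M : ℝ)⁻¹ * densInfo μ f (c.encR m) ≤
      ∑ m, (c.M : ℝ)⁻¹ * natEntropy (c.encR m) :=
    Finset.sum_le_sum fun m _ =>
      mul_le_mul_of_nonneg_left (densInfo_le_natEntropy hf (c.encR_mem m)) hM0
  change Real.log c.M + _ - natEntropy c.inputLaw ≤ _ at hH
  refine ⟨c.inputLaw, c.inputLaw_mem, by linarith, by linarith, ?_⟩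
  -- In general I(X;Y|M) is bounded by H(X|M), and log M + H(X|M) exceeds H(X) by no more than the
  -- bound on H(M|X).
  rcases hκ with rfl | ⟨rfl, hdet⟩
  · linarith
  · obtain ⟨g, hg⟩ := hdet.exists_encR
    -- For a deterministic encoder H(X|M) = 0, so the term I(X;Y|M) vanishes as well and log M need
    -- not be replaced by H(X).
    have hz : ∑ m, (c.M : ℝ)⁻¹ * natEntropy (c.encR m) = 0 :=
      Finset.sum_eq_zero fun m _ => by rw [(hg m).2, natEntropy_pure, mul_zero]
    have he0 : 0 ≤ e := le_trans (Finset.sum_nonneg fun a _ => mul_nonneg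
      ((c.encR_mem ⟨0, c.M_pos⟩).1 a) (by split_ifs <;> norm_num)) (he ⟨0, c.M_pos⟩)
    have h2 : 0 ≤ Real.log 2 + e * Real.log c.M := by
      have := Real.log_nonneg one_le_two
      have := Real.log_natCast_nonneg c.M
      positivity
    linarith

/-- A secure code does not exist for a channel whose output does not depend on the input. -/
lemma exists_ne_of_secure [∀ a, IsProbabilityMeasure (V a)] (hε : c.epsA V < 1 / 2)
    (hδ : c.deltaC V < 1 / 2 ∨ c.deltaD V < 1 / 2) : ∃ a a', V a ≠ V a' := by
  by_contra! h
  have hM : 1 < c.M := lt_of_le_of_lt c.L_pos c.L_lt_M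
  set m₀ : Fin c.M := ⟨0, c.M_pos⟩
  set m₁ : Fin c.M := ⟨1, hM⟩
  have hne : m₁ ≠ m₀ := fun h => one_ne_zero (congrArg Fin.val h)
  obtain ⟨a₀, -⟩ := (c.enc m₀).support_nonempty
  have hlaw : ∀ m, c.listProb (c.outputLaw V m) = c.listProb (V a₀) := by
    intro m
    funext m'
    rw [listProb_outputLaw]
    simp only [fun a => h a a₀, ← Finset.sum_mul, (c.encR_mem m).2, one_mul]
  have h0 := c.one_sub_epsA_le (V := V) m₀
  have h1 := c.one_sub_epsA_le (V := V) m₁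
  rcases hδ with hδ | hδ
  · have := c.listProb_le_deltaC (V := V) hne
    rw [hlaw] at this h1
    linarith
  · have := c.min_listProb_le_deltaD (V := V) a₀ hne
    rw [hlaw] at h0 h1
    have h2 : 1 / 2 < min (c.listProb (V a₀) m₁) (c.listProb (V a₀) m₀) :=
      lt_min (by linarith) (by linarith)
    linarith

end

end Code

/-! ### An interior point of the region -/

section
variable {X Y : Type*} [Fintype X] [MeasurableSpace Y] {μ : Measure Y} [IsFiniteMeasure μ]
  {f : X → Y → ℝ} {W : X → Measure Y}

lemma exists_pair_law [DecidableEq X] {a b : X} (hab : a ≠ b) :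
    ∃ p ∈ stdSimplex ℝ X, 0 < p a ∧ 0 < p b := by
  refine ⟨(1 / 2 : ℝ) • Pi.single a 1 + (1 / 2 : ℝ) • Pi.single b 1,
    convex_stdSimplex ℝ X (single_mem_stdSimplex ℝ a) (single_mem_stdSimplex ℝ b)
      (by norm_num) (by norm_num) (by norm_num), ?_, ?_⟩
  · simp [hab]
  · simp [hab.symm]

/-- If the information vanished, every letter of positive weight would have zero divergence from the
mixture, so W a and W b would both equal it. -/
lemma densInfo_pos (hf : IsDensity μ f)
    (hW : ∀ x, W x = μ.withDensity fun y => ENNReal.ofReal (f x y)) {p : X → ℝ}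
    (hp : p ∈ stdSimplex ℝ X) {a b : X} (ha : 0 < p a) (hb : 0 < p b) (hab : W a ≠ W b) :
    0 < densInfo μ f p := by
  refine (densInfo_nonneg hf hp).lt_of_ne fun h => hab ?_
  have hprob : ∀ x, IsProbabilityMeasure (W x) := fun x => by
    rw [hW]; exact isProbabilityMeasure_withDensity hf x
  have hprob' : IsProbabilityMeasure (outputMeasure W p) := by
    rw [outputMeasure_eq hf hW hp.1]; exact isProbabilityMeasure_withDensity (hf.mix_one hp) ()
  rw [← sum_mul_toReal_klDiv hf hW hp, eq_comm, Finset.sum_eq_zero_iff_of_nonneg fun x _ =>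
    mul_nonneg (hp.1 x) ENNReal.toReal_nonneg] at h
  have key : ∀ x, 0 < p x → W x = outputMeasure W p := by
    intro x hx
    have h1 := (mul_eq_zero.1 (h x (Finset.mem_univ x))).resolve_left hx.ne'
    rw [ENNReal.toReal_eq_zero_iff] at h1
    exact klDiv_eq_zero_iff.1 (h1.resolve_right (toReal_klDiv_mix hf hW hp hx).1)
  rw [key a ha, key b hb]

lemma negMulLog_sum_lt {A : Type*} [Fintype A] {c : A → ℝ} (hc : ∀ a, 0 ≤ c a) {a b : A}
    (hab : a ≠ b) (ha : 0 < c a) (hb : 0 < c b) :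
    negMulLog (∑ a, c a) < ∑ a, negMulLog (c a) := by
  classical
  have h1 : ∀ x, -(c x * Real.log (∑ a, c a)) ≤ negMulLog (c x) := by
    intro x
    rcases (hc x).eq_or_lt with h0 | h0
    · simp [← h0]
    · have := Real.log_le_log h0
        (Finset.single_le_sum (fun a _ => hc a) (Finset.mem_univ x))
      rw [negMulLog, neg_mul]
      nlinarith
  have hlt : c a < ∑ a, c a := by
    have h2 : ∑ x ∈ {a, b}, c x ≤ ∑ x, c x :=
      Finset.sum_le_sum_of_subset_of_nonneg (Finset.subset_univ _) fun x _ _ => hc x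
    rw [Finset.sum_pair hab] at h2
    linarith
  calc negMulLog (∑ a, c a) = ∑ x, -(c x * Real.log (∑ a, c a)) := by
        rw [Finset.sum_neg_distrib, ← Finset.sum_mul, negMulLog, neg_mul]
    _ < _ := Finset.sum_lt_sum (fun x _ => h1 x) ⟨a, Finset.mem_univ a, by
        have := mul_lt_mul_of_pos_left (Real.log_lt_log ha hlt) ha
        rw [negMulLog, neg_mul]
        linarith⟩

/-- Equality forces the posterior entropy to vanish almost everywhere, so f a and f b are almost
nowhere positive together; the zero set of f a then separates W a from W b. -/
lemma densInfo_lt_natEntropy (hf : IsDensity μ f)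
    (hW : ∀ x, W x = μ.withDensity fun y => ENNReal.ofReal (f x y)) {p : X → ℝ}
    (hp : p ∈ stdSimplex ℝ X) {a b : X} (hne : a ≠ b) (ha : 0 < p a) (hb : 0 < p b)
    (hab : ¬ W a ⟂ₘ W b) : densInfo μ f p < natEntropy p := by
  refine (densInfo_le_natEntropy hf hp).lt_of_ne fun h => hab ?_
  have hm := hf.mix_one hp
  have hi : ∀ x ∈ Finset.univ, Integrable (fun y => negMulLog (p x * f x y)) μ := fun x _ =>
    integrable_negMulLog ((hf.meas x).const_mul _) (fun y => mul_nonneg (hp.1 x) (hf.nonneg x y))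
      fun y => mul_le_one₀ (mem_Icc_of_mem_stdSimplex hp x).2 (hf.nonneg x y) (hf.le_one x y)
  have hint : Integrable (fun y => ∑ x, negMulLog (p x * f x y) -
      negMulLog (∑ x, p x * f x y)) μ :=
    (integrable_finsetSum _ hi).sub (hm.integrable_negMulLog ())
  have h0 := natEntropy_sub_densInfo hf hp
  rw [h, sub_self, eq_comm, integral_eq_zero_iff_of_nonneg (fun y => sub_nonneg.2
    (negMulLog_sum_le _ _ fun x _ => mul_nonneg (hp.1 x) (hf.nonneg x y))) hint] at h0
  have hs0 : MeasurableSet {y | f a y = 0} := hf.meas a (measurableSet_singleton 0)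
  refine ⟨{y | f a y = 0}, hs0, ?_, ?_⟩
  · rw [hW a, withDensity_apply _ hs0]
    refine (setLIntegral_congr_fun (g := fun _ => 0) hs0
      fun y hy => ?_).trans (by simp)
    have : f a y = 0 := hy
    simp [this]
  · have hs : MeasurableSet {y | f a y = 0}ᶜ := hs0.compl
    rw [hW b, withDensity_apply _ hs, setLIntegral_eq_zero_iff hs (hf.meas b).ennreal_ofReal]
    filter_upwards [h0] with y hy hya
    rw [ENNReal.ofReal_eq_zero]
    by_contra hyb
    have hya' : 0 < f a y := (hf.nonneg a y).lt_of_ne fun h => hya h.symm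
    have := negMulLog_sum_lt (c := fun x => p x * f x y)
      (fun x => mul_nonneg (hp.1 x) (hf.nonneg x y)) hne (mul_pos ha hya')
      (mul_pos hb (not_le.1 hyb))
    exact (sub_pos.2 this).ne' hy

/-- Two inputs with different output laws give I > 0; two inputs whose output laws are not singular
give I < H. The pairs may differ, but the midpoint of the two resulting points has both properties.
-/
lemma exists_interior (hf : IsDensity μ f)
    (hW : ∀ x, W x = μ.withDensity fun y => ENNReal.ofReal (f x y))
    (hnl : ¬ Noiseless W) (hne : ∃ x x', W x ≠ W x') :
    ∃ v ∈ infoSet μ f, 0 < v.1 ∧ v.1 < v.2 := by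
  classical
  obtain ⟨x, x', hxx⟩ := hne
  have hx : x ≠ x' := fun h => hxx (by rw [h])
  have hnt : Nontrivial X := ⟨x, x', hx⟩
  obtain ⟨a, b, hab, hsing⟩ : ∃ a b, a ≠ b ∧ ¬ W a ⟂ₘ W b := by
    by_contra! h
    exact hnl ⟨hnt, fun a b hab => h a b hab⟩
  obtain ⟨p, hp, hp1, hp2⟩ := exists_pair_law hx
  obtain ⟨q, hq, hq1, hq2⟩ := exists_pair_law hab
  have h1 := densInfo_pos hf hW hp hp1 hp2 hxx
  have h2 := densInfo_lt_natEntropy hf hW hq hab hq1 hq2 hsing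
  have h3 := densInfo_nonneg hf hq
  have h4 := densInfo_le_natEntropy hf hp
  refine ⟨_, convex_convexHull ℝ _ (mem_infoSet (μ := μ) (f := f) hp) (mem_infoSet hq)
    (a := 1 / 2) (b := 1 / 2) (by norm_num) (by norm_num) (by norm_num), ?_, ?_⟩ <;>
  · simp only [Prod.fst_add, Prod.smul_fst, Prod.snd_add, Prod.smul_snd, smul_eq_mul]
    linarith

end

/-! ### The converse -/

section
variable {X Y : Type*} [Fintype X] [MeasurableSpace Y] {μ : Measure Y} [IsFiniteMeasure μ]
  {f : X → Y → ℝ} {W : X → Measure Y}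

/-- The set `infoSet` in bits. -/
def bitSet (μ : Measure Y) (f : X → Y → ℝ) : Set (ℝ × ℝ) := {v | Real.log 2 • v ∈ infoSet μ f}

omit [IsFiniteMeasure μ] in
lemma convex_bitSet : Convex ℝ (bitSet μ f) :=
  (convex_convexHull ℝ _).is_linear_preimage
    (IsLinearMap.isLinearMap_smul (R := ℝ) (M := ℝ × ℝ) (Real.log 2))

omit [IsFiniteMeasure μ] in
lemma mem_bitSet {v : ℝ × ℝ} (hv : v ∈ infoSet μ f) :
    (v.1 / Real.log 2, v.2 / Real.log 2) ∈ bitSet μ f := by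
  have hlog : Real.log 2 ≠ 0 := (Real.log_pos one_lt_two).ne'
  change Real.log 2 • (v.1 / Real.log 2, v.2 / Real.log 2) ∈ infoSet μ f
  simpa [mul_div_cancel₀ _ hlog] using hv

lemma exists_joint_bits (hf : IsDensity μ f)
    (hW : ∀ x, W x = μ.withDensity fun y => ENNReal.ofReal (f x y)) {v : ℝ × ℝ}
    (hv : v ∈ bitSet μ f) :
    ∃ (k : ℕ) (P : Fin k × X → ℝ), P ∈ stdSimplex ℝ (Fin k × X) ∧
      condMutualInfo W P = v.1 ∧ condEntropy P = v.2 ∧ condEquivocation W P = v.2 - v.1 := by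
  have hlog : Real.log 2 ≠ 0 := (Real.log_pos one_lt_two).ne'
  obtain ⟨k, P, hP, h1, h2, h3⟩ := exists_joint hf hW hv
  refine ⟨k, P, hP, ?_, ?_, ?_⟩
  · rw [h1, Prod.smul_fst, smul_eq_mul, mul_div_cancel_left₀ _ hlog]
  · rw [h2, Prod.smul_snd, smul_eq_mul, mul_div_cancel_left₀ _ hlog]
  · rw [h3, Prod.smul_fst, Prod.smul_snd, smul_eq_mul, smul_eq_mul, ← mul_sub,
      mul_div_cancel_left₀ _ hlog]

/-- The bounds in nats are divided by n log 2, and a single large n serves for all three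
inequalities. -/
lemma approx_of_bounds [Nonempty X] (hf : IsDensity μ f)
    {c : ∀ n : ℕ, Code (Fin n → X) (Fin n → Y)} {R : ℝ × ℝ × ℝ} (hR : HasRates W c R)
    (hε : Tendsto (fun n => (c n).epsA (memoryless W n)) atTop (𝓝 0)) {e : ℕ → ℝ}
    (he : Tendsto e atTop (𝓝 0)) {κ : ℝ}
    (hb : ∀ᶠ n in atTop, ∃ p ∈ stdSimplex ℝ (Fin n → X),
      Real.log (c n).M - (Real.log 2 + e n * Real.log (c n).M) ≤ natEntropy p ∧
      (1 - (c n).epsA (memoryless W n)) * (Real.log (c n).M - Real.log (c n).L) - 1 ≤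
        densInfo (Measure.pi fun _ : Fin n => μ) (piDens f) p ∧
      (c n).equiv (memoryless W n) * Real.log 2 ≤ (1 - κ) * Real.log (c n).M +
        κ * natEntropy p - densInfo (Measure.pi fun _ : Fin n => μ) (piDens f) p +
        (Real.log 2 + e n * Real.log (c n).M))
    (hκ : 0 ≤ κ) (ε : ℝ) (hε0 : 0 < ε) :
    ∃ v ∈ bitSet μ f, R.1 - R.2.1 ≤ v.1 + ε ∧
      R.2.2 ≤ (1 - κ) * R.1 + κ * v.2 - v.1 + ε ∧ R.1 ≤ v.2 + ε := by
  obtain ⟨-, hM, hL, hE⟩ := hR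
  set a : ℕ → ℝ := fun n => Real.logb 2 (c n).M / n with ha
  set b : ℕ → ℝ := fun n => Real.logb 2 (c n).L / n with hb'
  have hlog : 0 < Real.log 2 := Real.log_pos one_lt_two
  have hinv : Tendsto (fun n : ℕ => (1 : ℝ) / n) atTop (𝓝 0) := tendsto_one_div_atTop_nhds_zero_nat
  have herr : Tendsto (fun n : ℕ => 1 / (n : ℝ) + e n * a n) atTop (𝓝 0) := by
    simpa using hinv.add (he.mul hM)
  have t1 : Tendsto (fun n : ℕ => a n - (1 / (n : ℝ) + e n * a n)) atTop (𝓝 R.1) := by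
    simpa using hM.sub herr
  have t2 : Tendsto (fun n : ℕ => (1 - (c n).epsA (memoryless W n)) * (a n - b n) -
      (Real.log 2)⁻¹ * (1 / (n : ℝ))) atTop (𝓝 (R.1 - R.2.1)) := by
    simpa using ((hε.const_sub 1).mul (hM.sub hL)).sub (hinv.const_mul (Real.log 2)⁻¹)
  have t3 : Tendsto (fun n : ℕ => (1 - κ) * a n + (1 / (n : ℝ) + e n * a n)) atTop
      (𝓝 ((1 - κ) * R.1)) := by
    simpa using (hM.const_mul (1 - κ)).add herr
  obtain ⟨n, ⟨p, hp, p1, p2, p3⟩, hn, g1, g2, g3, g4⟩ := (hb.and ((eventually_gt_atTop 0).and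
    ((t1.eventually (lt_mem_nhds (sub_lt_self R.1 hε0))).and
    ((t2.eventually (lt_mem_nhds (sub_lt_self (R.1 - R.2.1) hε0))).and
    ((t3.eventually (gt_mem_nhds (lt_add_of_pos_right ((1 - κ) * R.1) (half_pos hε0)))).and
    (hE (ε / 2) (half_pos hε0))))))).exists
  have hn' : (0 : ℝ) < n := Nat.cast_pos.2 hn
  obtain ⟨v, hv, v1, v2⟩ := exists_infoSet_eq hf n p hp
  -- Exactness is essential here: the information is bounded below in `p2` and enters with a
  -- negative sign in `p3`.
  rw [← v1] at p2 p3
  have eM : Real.log (c n).M = n * Real.log 2 * a n := by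
    simp only [ha, Real.logb]; field_simp
  have eL : Real.log (c n).L = n * Real.log 2 * b n := by
    simp only [hb', Real.logb]; field_simp
  have hd : 0 < n * Real.log 2 := mul_pos hn' hlog
  have hv2 : (n * Real.log 2) * (a n - (1 / (n : ℝ) + e n * a n)) ≤
      (n * Real.log 2) * (v.2 / Real.log 2) := by
    calc _ = Real.log (c n).M - (Real.log 2 + e n * Real.log (c n).M) := by
          rw [eM]; field_simp
      _ ≤ n * v.2 := p1.trans v2
      _ = _ := by field_simp
  have hv1 : (n * Real.log 2) * ((1 - (c n).epsA (memoryless W n)) * (a n - b n) -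
      (Real.log 2)⁻¹ * (1 / (n : ℝ))) ≤ (n * Real.log 2) * (v.1 / Real.log 2) := by
    calc _ = (1 - (c n).epsA (memoryless W n)) * (Real.log (c n).M - Real.log (c n).L) - 1 := by
          rw [eM, eL]; field_simp
      _ ≤ n * v.1 := p2
      _ = _ := by field_simp
  have hv3 : (n * Real.log 2) * ((c n).equiv (memoryless W n) / n) ≤
      (n * Real.log 2) * ((1 - κ) * a n + κ * (v.2 / Real.log 2) - v.1 / Real.log 2 +
        (1 / (n : ℝ) + e n * a n)) := by
    calc _ = (c n).equiv (memoryless W n) * Real.log 2 := by field_simp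
      _ ≤ (1 - κ) * Real.log (c n).M + κ * (n * v.2) - n * v.1 +
          (Real.log 2 + e n * Real.log (c n).M) := by
          have := mul_le_mul_of_nonneg_left v2 hκ
          linarith
      _ = _ := by rw [eM]; field_simp
  have w1 := le_of_mul_le_mul_left hv1 hd
  have w2 := le_of_mul_le_mul_left hv2 hd
  have w3 := le_of_mul_le_mul_left hv3 hd
  refine ⟨_, mem_bitSet hv, ?_, ?_, ?_⟩ <;> dsimp only <;> linarith

lemma HasRates.list_le {c : ∀ n : ℕ, Code (Fin n → X) (Fin n → Y)} {R : ℝ × ℝ × ℝ}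
    (hR : HasRates W c R) : R.2.1 ≤ R.1 := by
  refine le_of_tendsto_of_tendsto' hR.2.2.1 hR.2.1 fun n => ?_
  have h1 : (0 : ℝ) < (c n).L := Nat.cast_pos.2 (c n).L_pos
  have h2 : ((c n).L : ℝ) ≤ (c n).M := Nat.cast_le.2 (c n).L_lt_M.le
  exact div_le_div_of_nonneg_right (Real.logb_le_logb_of_le one_lt_two h1 h2) (Nat.cast_nonneg n)

lemma exists_ne_of_secure [∀ x, IsProbabilityMeasure (W x)]
    {c : ∀ n : ℕ, Code (Fin n → X) (Fin n → Y)}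
    (hε : Tendsto (fun n => (c n).epsA (memoryless W n)) atTop (𝓝 0))
    (hδ : Tendsto (fun n => (c n).deltaC (memoryless W n)) atTop (𝓝 0) ∨
      Tendsto (fun n => (c n).deltaD (memoryless W n)) atTop (𝓝 0)) :
    ∃ x x', W x ≠ W x' := by
  have hprob : ∀ n x, IsProbabilityMeasure (memoryless W n x) := fun n x => by
    unfold memoryless; infer_instance
  have hhalf : (0 : ℝ) < 1 / 2 := by norm_num
  obtain ⟨n, h1, h2⟩ : ∃ n, (c n).epsA (memoryless W n) < 1 / 2 ∧
      ((c n).deltaC (memoryless W n) < 1 / 2 ∨ (c n).deltaD (memoryless W n) < 1 / 2) := by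
    rcases hδ with hδ | hδ
    · obtain ⟨n, h1, h2⟩ := ((hε.eventually (gt_mem_nhds hhalf)).and
        (hδ.eventually (gt_mem_nhds hhalf))).exists
      exact ⟨n, h1, Or.inl h2⟩
    · obtain ⟨n, h1, h2⟩ := ((hε.eventually (gt_mem_nhds hhalf)).and
        (hδ.eventually (gt_mem_nhds hhalf))).exists
      exact ⟨n, h1, Or.inr h2⟩
  obtain ⟨x, x', h⟩ := (c n).exists_ne_of_secure h1 h2
  by_contra! hall
  exact h (by simp only [memoryless, fun i => hall (x i) (x' i)])

/-- The case κ = 0, where the bound on R₃ is R₁ − I(X;Y|U); κ = 1 gives H(X|U) − I(X;Y|U) = H(X|YU),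
the bound in `regionCs`. -/
lemma mem_closure_regionC [Nonempty X] (hf : IsDensity μ f)
    (hW : ∀ x, W x = μ.withDensity fun y => ENNReal.ofReal (f x y))
    {v₀ : ℝ × ℝ} (hv₀ : v₀ ∈ bitSet μ f) (h₀ : 0 < v₀.1) (h₁ : v₀.1 < v₀.2) {R : ℝ × ℝ × ℝ}
    (h2 : 0 ≤ R.2.1) (h3 : 0 ≤ R.2.2) (h12 : R.2.1 ≤ R.1)
    (happ : ∀ ε > 0, ∃ v ∈ bitSet μ f, R.1 - R.2.1 ≤ v.1 + ε ∧
      R.2.2 ≤ (1 - 0) * R.1 + 0 * v.2 - v.1 + ε ∧ R.1 ≤ v.2 + ε) :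
    R ∈ closure (regionC W) := by
  refine mem_closure_of_approx convex_bitSet le_rfl ?_ hv₀ h₀ h₁ h2 h3 h12 happ
  intro v hv R₁ R₂ R₃ a1 a2 a3 a4 a5 a6 a7
  obtain ⟨k, P, hP, e1, e2, -⟩ := exists_joint_bits hf hW hv
  refine ⟨k, P, hP, a1, ?_, ?_, ?_, a5, a6, a7⟩
  · rwa [e1]
  · rw [e1]; dsimp only; linarith
  · rwa [e2]

lemma mem_closure_regionCs [Nonempty X] (hf : IsDensity μ f)
    (hW : ∀ x, W x = μ.withDensity fun y => ENNReal.ofReal (f x y))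
    {v₀ : ℝ × ℝ} (hv₀ : v₀ ∈ bitSet μ f) (h₀ : 0 < v₀.1) (h₁ : v₀.1 < v₀.2) {R : ℝ × ℝ × ℝ}
    (h2 : 0 ≤ R.2.1) (h3 : 0 ≤ R.2.2) (h12 : R.2.1 ≤ R.1)
    (happ : ∀ ε > 0, ∃ v ∈ bitSet μ f, R.1 - R.2.1 ≤ v.1 + ε ∧
      R.2.2 ≤ (1 - 1) * R.1 + 1 * v.2 - v.1 + ε ∧ R.1 ≤ v.2 + ε) :
    R ∈ closure (regionCs W) := by
  refine mem_closure_of_approx convex_bitSet zero_le_one ?_ hv₀ h₀ h₁ h2 h3 h12 happ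
  intro v hv R₁ R₂ R₃ a1 a2 a3 a4 a5 a6 a7
  obtain ⟨k, P, hP, e1, e2, e3⟩ := exists_joint_bits hf hW hv
  refine ⟨k, P, hP, a1, ?_, ?_, ?_, a5, a6, a7⟩
  · rwa [e1]
  · rw [e3]; dsimp only; linarith
  · rwa [e2]

lemma exists_bitSet_interior (hf : IsDensity μ f)
    (hW : ∀ x, W x = μ.withDensity fun y => ENNReal.ofReal (f x y))
    (hnl : ¬ Noiseless W) (hne : ∃ x x', W x ≠ W x') :
    ∃ v ∈ bitSet μ f, 0 < v.1 ∧ v.1 < v.2 := by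
  obtain ⟨v, hv, h1, h2⟩ := exists_interior hf hW hnl hne
  have hlog : 0 < Real.log 2 := Real.log_pos one_lt_two
  exact ⟨_, mem_bitSet hv, div_pos h1 hlog, div_lt_div_of_pos_right h2 hlog⟩

end

/-! ### The three inclusions -/

section
variable {X Y : Type*} [Fintype X] [MeasurableSpace Y] (W : X → Measure Y)
  [∀ x, IsProbabilityMeasure (W x)]

lemma regionWD_subset (hnl : ¬ Noiseless W) : regionWD W ⊆ closure (regionC W) := by
  classical
  rintro R ⟨c, hdet, ⟨hε, hδ⟩, hR⟩
  obtain ⟨μ, f, _, hf, hW⟩ := exists_isDensity W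
  have hne := exists_ne_of_secure hε (Or.inl hδ)
  have hX : Nonempty X := ⟨hne.choose⟩
  obtain ⟨v₀, hv₀, h₀, h₁⟩ := exists_bitSet_interior hf hW hnl hne
  refine mem_closure_regionC hf hW hv₀ h₀ h₁ hR.1.2.1 hR.1.2.2 hR.list_le
    (approx_of_bounds hf hR hε (e := fun _ => 0) tendsto_const_nhds ?_ le_rfl)
  have hhalf : (0 : ℝ) < 1 / 2 := by norm_num
  filter_upwards [hε.eventually (gt_mem_nhds hhalf), hδ.eventually (gt_mem_nhds hhalf)]
    with n h1 h2
  -- A message is good for its own codeword only, so the input determines it without error and e =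
  -- 0.
  refine (c n).exists_inputLaw_bounds (hf.pi n) (withDensity_pi hf hW)
    (fun m a => (c n).encR m a ≠ 0) ((hdet n).encR_unique h1 h2) (fun m => ?_)
    (Or.inr ⟨rfl, hdet n⟩)
  refine (Finset.sum_eq_zero fun a _ => ?_).le
  by_cases h : (c n).encR m a = 0 <;> simp [h]

variable {W} in
lemma StronglySecure.exists_inputLaw_bounds {c : ∀ n : ℕ, Code (Fin n → X) (Fin n → Y)}
    (hs : StronglySecure W c) {μ : Measure Y} [IsFiniteMeasure μ] {f : X → Y → ℝ}
    (hf : IsDensity μ f) (hW : ∀ x, W x = μ.withDensity fun y => ENNReal.ofReal (f x y)) {κ : ℝ}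
    (hκ : κ = 1 ∨ κ = 0 ∧ ∀ n, (c n).IsDeterministic) :
    ∀ᶠ n in atTop, ∃ p ∈ stdSimplex ℝ (Fin n → X),
      Real.log (c n).M - (Real.log 2 + 2 * (c n).epsA (memoryless W n) * Real.log (c n).M) ≤
        natEntropy p ∧
      (1 - (c n).epsA (memoryless W n)) * (Real.log (c n).M - Real.log (c n).L) - 1 ≤
        densInfo (Measure.pi fun _ : Fin n => μ) (piDens f) p ∧
      (c n).equiv (memoryless W n) * Real.log 2 ≤ (1 - κ) * Real.log (c n).M +
        κ * natEntropy p - densInfo (Measure.pi fun _ : Fin n => μ) (piDens f) p +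
        (Real.log 2 + 2 * (c n).epsA (memoryless W n) * Real.log (c n).M) := by
  classical
  have hhalf : (0 : ℝ) < 1 / 2 := by norm_num
  filter_upwards [hs.2.eventually (gt_mem_nhds hhalf)] with n h2
  have hprob : ∀ x, IsProbabilityMeasure (memoryless W n x) := fun x => by
    unfold memoryless; infer_instance
  -- A message is good for the inputs from which it is likely to be listed; the error is then 2
  -- `epsA`, which tends to 0.
  exact (c n).exists_inputLaw_bounds (hf.pi n) (withDensity_pi hf hW)
    (fun m a => (c n).LikelyFrom (memoryless W n) m a)
    (fun a m m' h h' => Code.LikelyFrom.unique h2 a m m' h h')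
    (fun m => (c n).sum_not_likelyFrom_le m) (hκ.imp_right fun h => ⟨h.1, h.2 n⟩)

lemma regionSD_subset (hnl : ¬ Noiseless W) : regionSD W ⊆ closure (regionC W) := by
  rintro R ⟨c, hdet, hs, hR⟩
  obtain ⟨μ, f, _, hf, hW⟩ := exists_isDensity W
  have hne := exists_ne_of_secure hs.1 (Or.inr hs.2)
  have hX : Nonempty X := ⟨hne.choose⟩
  obtain ⟨v₀, hv₀, h₀, h₁⟩ := exists_bitSet_interior hf hW hnl hne
  exact mem_closure_regionC hf hW hv₀ h₀ h₁ hR.1.2.1 hR.1.2.2 hR.list_le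
    (approx_of_bounds hf hR hs.1 (by simpa using hs.1.const_mul 2)
      (hs.exists_inputLaw_bounds hf hW (Or.inr ⟨rfl, hdet⟩)) le_rfl)

lemma regionSS_subset (hnl : ¬ Noiseless W) : regionSS W ⊆ closure (regionCs W) := by
  rintro R ⟨c, hs, hR⟩
  obtain ⟨μ, f, _, hf, hW⟩ := exists_isDensity W
  have hne := exists_ne_of_secure hs.1 (Or.inr hs.2)
  have hX : Nonempty X := ⟨hne.choose⟩
  obtain ⟨v₀, hv₀, h₀, h₁⟩ := exists_bitSet_interior hf hW hnl hne
  exact mem_closure_regionCs hf hW hv₀ h₀ h₁ hR.1.2.1 hR.1.2.2 hR.list_le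
    (approx_of_bounds hf hR hs.1 (by simpa using hs.1.const_mul 2)
      (hs.exists_inputLaw_bounds hf hW (Or.inl rfl)) zero_le_one)

end

end SecureListDecoding
end

theorem mainTheorem3 {X Y : Type*} [Fintype X] [MeasurableSpace Y]
    (W : X → Measure Y) [∀ x, IsProbabilityMeasure (W x)]
    (hW : ¬ SecureListDecoding.Noiseless W) :
    SecureListDecoding.regionWD W ⊆ closure (SecureListDecoding.regionC W) ∧
    SecureListDecoding.regionSS W ⊆ closure (SecureListDecoding.regionCs W) ∧
    SecureListDecoding.regionSD W ⊆ closure (SecureListDecoding.regionC W) :=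
  ⟨SecureListDecoding.regionWD_subset W hW, SecureListDecoding.regionSS_subset W hW,
    SecureListDecoding.regionSD_subset W hW⟩
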